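/- **Setting.** Let $S$ be a smooth Hausdorff, $\sigma$-compact manifold of dimension $d$ without boundary, and let $X\colon S\to\mathbb R^n$ be a smooth map into $n$-dimensional Minkowski space with metric $h=\mathrm{diag}(-1,1,\dots,1)$, such that the induced metric $g_{\mu\nu}=h_{ab}\,\partial_\mu X^a\partial_\nu X^b$ has signature $(-,+,\dots,+)$ at every point (in particular $dX$ has rank $d$). Let $\nabla$ be the Levi-Civita connection of $g$ and $\Box=\nabla^\mu\partial_\mu$ the d'Alembertian of functions, applied componentwise to $\mathbb R^n$-valued functions. Assume that $X$ is on-shell for the Nambu–Goto action, i.e. $\Box X^a=0$ for all $a$. **Generators.** Consider fields $\Phi^a$ (fluctuation), $C^\mu$ (ghost), $\bar C^\mu$ (antighost), $B^\mu$ (auxiliary field) and antifields $\Phi^\ddagger_a, C^\ddagger_\mu,\bar C^\ddagger_\mu,B^\ddagger_\mu$ (taken relative to the density $\sqrt{-g}\,dx$), with ghost numbers $$\Phi:0,\quad C:1,\quad \bar C:-1,\quad B:0,\quad \Phi^\ddagger:-1,\quad C^\ddagger:-2,\quad \bar C^\ddagger:0,\quad B^\ddagger:-1 .$$ Indices $a$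 run over $1,\dots,n$, indices $\mu$ are (co)tangent indices on $S$. A *local $p$-form* of ghost number $g$ is a polynomial of total ghost number $g$ in these generators and finitely many of their derivatives with values in the complex differential $p$-forms on $S$, the coefficients being arbitrary smooth functions on $S$; generators of odd ghost number anticommute with each other and those of even ghost number commute with everything. The exterior derivative acts on the values of local forms and defines a differential $d$ raising $p$ by one. **Differential.** Let $J(\Phi)^a$ be the linearization at $X$ in direction $\Phi$ of $\frac{1}{\sqrt{-g}}\partial_\mu(\sqrt{-g}\,g^{\mu\nu}\partial_\nu X^a)$; explicitly $$J(\Phi)^a=\nabla_\mu\Big(g^{\mu\nu}\partial_\nu\Phi^a+\big(\tfrac12 g^{\mu\nu}\eta^\lambda{}_\lambda-\eta^{\mu\nu}\big)\partial_\nu X^a\Big),\qquad \eta_{\mu\nu}=h_{bc}(\partial_\mu X^b\partial_\nu\Phi^c+\partial_\nu X^b\partial_\mu\Phi^c).$$ For a real parameter $\zeta$, the free BV differential $s_0$ is the graded derivation of ghost number $1$, commuting with derivatives, with $$s_0\Phi^a=C^\mu\partial_\mu X^a,\quad s_0C^\mu=0,\quad s_0\bar C^\mu=iB^\mu,\quad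 s_0B^\mu=0,$$ $$s_0\Phi^\ddagger_a=-h_{ab}J(\Phi)^b-\zeta\,h_{ab}\Box(B^\mu\partial_\mu X^b),\qquad s_0C^\ddagger_\mu=\partial_\mu X^a\big(\Phi^\ddagger_a-i\zeta\,h_{ab}\Box(\bar C^\nu\partial_\nu X^b)\big),$$ $$s_0\bar C^\ddagger_\mu=i\zeta\,\partial_\mu X^a h_{ab}\Box(C^\nu\partial_\nu X^b),\qquad s_0B^\ddagger_\mu=-i\bar C^\ddagger_\mu-\zeta\,\partial_\mu X^a h_{ab}\Box\Phi^b .$$ The value $\zeta=1$ gives the gauge-fixed theory, and $\zeta=0$ the theory before gauge fixing. **Proposition.** The cohomology $H(s_0)$ and the relative cohomology $H(s_0|d)$ on local forms vanish at positive ghost number. That is, for every $\zeta$, every ghost number $g>0$ and every form degree $p\ge 0$: 1. every local $p$-form $F$ of ghost number $g$ with $s_0F=0$ is $F=s_0F'$ for a local $p$-form $F'$ of ghost number $g-1$; 2. every local $p$-form $F$ of ghost number $g$ such that $s_0F+dG=0$ for some local $(p-1)$-form $G$ of ghost number $g+1$ is $F=s_0F'+dG'$ with a local $p$-form $F'$ of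 ghost number $g-1$ and a local $(p-1)$-form $G'$ of ghost number $g$. (For $p=0$ the terms $dG$ and $dG'$ are absent.) -/

import Mathlib

open scoped Manifold ContDiff

noncomputable section

namespace NambuGoto

section Geometry

variable {d : ℕ} {S : Type*} [TopologicalSpace S] [ChartedSpace (EuclideanSpace ℝ (Fin d)) S]

/-- The differential at `x` of a map from the manifold `S` to a vector space; the tangent space
at `x` is identified with `ℝ^d` by the preferred chart at `x`, as everywhere in Mathlib. -/
def dAt {F : Type*} [NormedAddCommGroup F] [NormedSpace ℝ F] (f : S → F) (x : S) :
    EuclideanSpace ℝ (Fin d) →L[ℝ] F :=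
  mfderiv (𝓡 d) 𝓘(ℝ, F) f x

/-- The `μ`-th partial derivative at `x` (with respect to the basis `e μ` of the tangent space). -/
def partialAt {F : Type*} [NormedAddCommGroup F] [NormedSpace ℝ F] (f : S → F) (x : S)
    (μ : Fin d) : F :=
  dAt f x (EuclideanSpace.single μ (1 : ℝ))

/-- The diagonal entries `h_aa` of the Minkowski metric `diag(-1, 1, …, 1)` on `ℝ^n`. -/
def minkowski {n : ℕ} (a : Fin n) : ℝ := if (a : ℕ) = 0 then -1 else 1

/-- The induced metric `g = X^* h`, `g_x(u, v) = h(dX_x u, dX_x v)`. -/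
def inducedMetric {n : ℕ} (X : S → Fin n → ℝ) (x : S) (u v : EuclideanSpace ℝ (Fin d)) : ℝ :=
  ∑ a, minkowski a * (dAt X x u a * dAt X x v a)

/-- A background: a smooth map `X` from the `d`-dimensional manifold `S` to `n`-dimensional Minkowski
space whose induced metric has signature `(-, +, …, +)` at every point (so that `dX` has maximal
rank `d`). -/
structure Background (d : ℕ) (S : Type*) [TopologicalSpace S]
    [ChartedSpace (EuclideanSpace ℝ (Fin d)) S] (n : ℕ) where
  X : S → Fin n → ℝ
  smooth : ContMDiff (𝓡 d) 𝓘(ℝ, Fin n → ℝ) ∞ X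
  lorentzian : ∀ x : S, ∃ t : EuclideanSpace ℝ (Fin d), inducedMetric X x t t < 0 ∧
    ∀ u : EuclideanSpace ℝ (Fin d), u ≠ 0 → inducedMetric X x t u = 0 → 0 < inducedMetric X x u u

/-- The matrix `g_μν` of the induced metric at `x`. -/
def Background.gram {n : ℕ} (W : Background d S n) (x : S) : Matrix (Fin d) (Fin d) ℝ :=
  fun μ ν => inducedMetric W.X x (EuclideanSpace.single μ (1 : ℝ)) (EuclideanSpace.single ν (1 : ℝ))

/-- The pairing `g^μν ∂_μ f ∂_ν k` of two differentials by the inverse metric. -/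
def Background.cometric {n : ℕ} (W : Background d S n) (f k : S → ℂ) (x : S) : ℂ :=
  ∑ μ, ∑ ν, (((W.gram x)⁻¹ μ ν : ℝ) : ℂ) * (partialAt f x μ * partialAt k x ν)

theorem eq_sum_single (u : EuclideanSpace ℝ (Fin d)) :
    u = ∑ μ, u μ • (EuclideanSpace.single μ (1 : ℝ) : EuclideanSpace ℝ (Fin d)) := by
  ext i
  simp [Finset.sum_apply, Pi.single_apply]

theorem clm_eq_sum {F : Type*} [NormedAddCommGroup F] [NormedSpace ℝ F]
    (A : EuclideanSpace ℝ (Fin d) →L[ℝ] F) (u : EuclideanSpace ℝ (Fin d)) :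
    A u = ∑ μ, u μ • A (EuclideanSpace.single μ (1 : ℝ)) := by
  conv_lhs => rw [eq_sum_single u, map_sum]
  simp

theorem Background.inducedMetric_eq {n : ℕ} (W : Background d S n) (x : S)
    (u v : EuclideanSpace ℝ (Fin d)) :
    inducedMetric W.X x u v = u.ofLp ⬝ᵥ (W.gram x).mulVec v.ofLp := by
  have key : ∀ (u : EuclideanSpace ℝ (Fin d)) (a : Fin n), dAt W.X x u a
      = ∑ μ, u μ * dAt W.X x (EuclideanSpace.single μ (1 : ℝ)) a := by
    intro u a
    rw [clm_eq_sum, Finset.sum_apply]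
    rfl
  simp only [dotProduct, Matrix.mulVec, Background.gram, inducedMetric, key u, key v,
    Finset.mul_sum, Finset.sum_mul]
  rw [Finset.sum_comm]
  conv_lhs =>
    rw [Finset.sum_congr rfl (fun μ _ => Finset.sum_comm)]
  rw [Finset.sum_comm]
  refine Finset.sum_congr rfl fun μ _ => Finset.sum_congr rfl fun ν _ =>
    Finset.sum_congr rfl fun a _ => ?_
  ring

theorem Background.gram_det_ne_zero {n : ℕ} (W : Background d S n) (x : S) :
    (W.gram x).det ≠ 0 := by
  intro h0
  obtain ⟨v, hv, hGv⟩ := Matrix.exists_mulVec_eq_zero_iff.mpr h0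
  obtain ⟨t, ht, hpos⟩ := W.lorentzian x
  have hz : ∀ w, inducedMetric W.X x w (WithLp.toLp 2 v) = 0 := by
    intro w
    rw [W.inducedMetric_eq]
    change _ ⬝ᵥ (W.gram x).mulVec v = 0
    rw [hGv, dotProduct_zero]
  have := hpos (WithLp.toLp 2 v) (by simpa using hv) (hz t)
  rw [hz] at this
  exact lt_irrefl _ this

theorem contMDiffAt_det {m : ℕ} {M : S → Matrix (Fin m) (Fin m) ℝ} {x₀ : S}
    (hM : ∀ i j, ContMDiffAt (𝓡 d) 𝓘(ℝ, ℝ) ∞ (fun x => M x i j) x₀) :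
    ContMDiffAt (𝓡 d) 𝓘(ℝ, ℝ) ∞ (fun x => (M x).det) x₀ := by
  simp only [Matrix.det_apply']
  exact ContMDiffAt.sum fun σ _ => contMDiffAt_const.mul (ContMDiffAt.prod fun i _ => hM _ _)

theorem contMDiffAt_matrix_inv {m : ℕ} {M : S → Matrix (Fin m) (Fin m) ℝ} {x₀ : S}
    (hM : ∀ i j, ContMDiffAt (𝓡 d) 𝓘(ℝ, ℝ) ∞ (fun x => M x i j) x₀) (h0 : (M x₀).det ≠ 0)
    (i j : Fin m) :
    ContMDiffAt (𝓡 d) 𝓘(ℝ, ℝ) ∞ (fun x => (M x)⁻¹ i j) x₀ := by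
  have : (fun x => (M x)⁻¹ i j) =
      fun x => ((M x).det)⁻¹ * ((M x).updateRow j (Pi.single i 1)).det := by
    funext x
    rw [Matrix.inv_def, Matrix.smul_apply, Matrix.adjugate_apply, Ring.inverse_eq_inv', smul_eq_mul]
  rw [this]
  refine ((contMDiffAt_det hM).inv₀ h0).mul (contMDiffAt_det fun k l => ?_)
  by_cases hk : k = j
  · subst hk
    simpa using contMDiffAt_const
  · simpa [Matrix.updateRow_ne hk] using hM k l

theorem contMDiffAt_mul {f g : S → ℂ} {x : S} (hf : ContMDiffAt (𝓡 d) 𝓘(ℝ, ℂ) ∞ f x)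
    (hg : ContMDiffAt (𝓡 d) 𝓘(ℝ, ℂ) ∞ g x) :
    ContMDiffAt (𝓡 d) 𝓘(ℝ, ℂ) ∞ (fun y => f y * g y) x :=
  (contDiff_mul (𝕜 := ℝ) (𝔸 := ℂ)).contMDiff.contMDiffAt.comp x (hf.prodMk_space hg)

theorem partialAt_add {f k : S → ℂ} (hf : ContMDiff (𝓡 d) 𝓘(ℝ, ℂ) ∞ f)
    (hk : ContMDiff (𝓡 d) 𝓘(ℝ, ℂ) ∞ k) (x : S) (μ : Fin d) :
    partialAt (fun y => f y + k y) x μ = partialAt f x μ + partialAt k x μ := by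
  have h := ((hf.mdifferentiable (by simp) x).hasMFDerivAt.add
    (hk.mdifferentiable (by simp) x).hasMFDerivAt).mfderiv
  exact congrArg (fun A : EuclideanSpace ℝ (Fin d) →L[ℝ] ℂ => A (EuclideanSpace.single μ 1)) h

theorem partialAt_mul {f k : S → ℂ} (hf : ContMDiff (𝓡 d) 𝓘(ℝ, ℂ) ∞ f)
    (hk : ContMDiff (𝓡 d) 𝓘(ℝ, ℂ) ∞ k) (x : S) (μ : Fin d) :
    partialAt (fun y => f y * k y) x μ = f x * partialAt k x μ + k x * partialAt f x μ := by
  have h := ((hf.mdifferentiable (by simp) x).hasMFDerivAt.mul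
    (hk.mdifferentiable (by simp) x).hasMFDerivAt).mfderiv
  exact congrArg (fun A : EuclideanSpace ℝ (Fin d) →L[ℝ] ℂ => A (EuclideanSpace.single μ 1)) h

theorem partialAt_const (c : ℂ) (x : S) (μ : Fin d) : partialAt (fun _ => c) x μ = 0 := by
  have h : mfderiv (𝓡 d) 𝓘(ℝ, ℂ) (fun _ : S => c) x = 0 := mfderiv_const
  exact congrArg (fun A : EuclideanSpace ℝ (Fin d) →L[ℝ] ℂ => A (EuclideanSpace.single μ 1)) h

variable [IsManifold (𝓡 d) ∞ S]

/-- The change of basis at `x` from the chart at `x₀` to the chart at `x`. -/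
def chartChange (x₀ x : S) : EuclideanSpace ℝ (Fin d) →L[ℝ] EuclideanSpace ℝ (Fin d) :=
  tangentCoordChange (𝓡 d) x₀ x x

/-- The matrix of `chartChange`. -/
def chartMatrix (x₀ x : S) : Matrix (Fin d) (Fin d) ℝ :=
  fun μ ν => chartChange x₀ x (EuclideanSpace.single ν (1 : ℝ)) μ

theorem chartMatrix_det_ne_zero {x₀ x : S}
    (hx : x ∈ (chartAt (EuclideanSpace ℝ (Fin d)) x₀).source) :
    (chartMatrix (d := d) x₀ x).det ≠ 0 := by
  intro h0
  obtain ⟨v, hv, hGv⟩ := Matrix.exists_mulVec_eq_zero_iff.mpr h0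
  apply hv
  have h1 : chartChange x₀ x (WithLp.toLp 2 v : EuclideanSpace ℝ (Fin d)) = 0 := by
    rw [clm_eq_sum]
    ext i
    have := congrFun hGv i
    simp only [Matrix.mulVec, dotProduct, chartMatrix] at this
    simpa [mul_comm] using this
  have h2 := tangentCoordChange_comp (I := 𝓡 d) (w := x₀) (x := x) (y := x₀) (z := x)
    (v := (WithLp.toLp 2 v : EuclideanSpace ℝ (Fin d))) (by simpa using hx)
  change tangentCoordChange (𝓡 d) x x₀ x (chartChange x₀ x _) = _ at h2
  rw [h1, map_zero, tangentCoordChange_self (by simpa using hx)] at h2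
  simpa using h2.symm

theorem inTangentCoordinates_eq_chartChange {F : Type*} [NormedAddCommGroup F] [NormedSpace ℝ F]
    (f : S → F) {x₀ x : S} (hx : x ∈ (chartAt (EuclideanSpace ℝ (Fin d)) x₀).source) :
    (inTangentCoordinates (𝓡 d) 𝓘(ℝ, F) id f (dAt f) x₀ x : EuclideanSpace ℝ (Fin d) →L[ℝ] F) =
      (dAt f x).comp (chartChange x₀ x) := by
  rw [inTangentCoordinates_eq (I := 𝓡 d) (I' := 𝓘(ℝ, F)) id f (dAt f) hx
    (by rw [chartAt_self_eq]; exact Set.mem_univ _),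
    tangentBundleCore_coordChange_model_space]
  rfl

theorem contMDiffAt_dAt {F : Type*} [NormedAddCommGroup F] [NormedSpace ℝ F] {f : S → F}
    {x₀ : S} (hf : ContMDiffAt (𝓡 d) 𝓘(ℝ, F) ∞ f x₀) (v : EuclideanSpace ℝ (Fin d)) :
    ContMDiffAt (𝓡 d) 𝓘(ℝ, F) ∞ (fun x => dAt f x (chartChange x₀ x v)) x₀ := by
  have h1 : ContMDiffAt (𝓡 d) 𝓘(ℝ, EuclideanSpace ℝ (Fin d) →L[ℝ] F) ∞
      (inTangentCoordinates (𝓡 d) 𝓘(ℝ, F) id f (dAt f) x₀) x₀ :=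
    hf.mfderiv_const (m := ∞) (by simp)
  refine (h1.clm_apply (contMDiffAt_const (c := v))).congr_of_eventuallyEq ?_
  filter_upwards [(chartAt (EuclideanSpace ℝ (Fin d)) x₀).open_source.mem_nhds
    (mem_chart_source _ x₀)] with x hx
  rw [inTangentCoordinates_eq_chartChange f hx]
  rfl

theorem Background.contMDiff_cometric {n : ℕ} (W : Background d S n) {f k : S → ℂ}
    (hf : ContMDiff (𝓡 d) 𝓘(ℝ, ℂ) ∞ f) (hk : ContMDiff (𝓡 d) 𝓘(ℝ, ℂ) ∞ k) :
    ContMDiff (𝓡 d) 𝓘(ℝ, ℂ) ∞ (W.cometric f k) := by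
  intro x₀
  let e (ν : Fin d) : EuclideanSpace ℝ (Fin d) := EuclideanSpace.single ν (1 : ℝ)
  let G₀ : S → Matrix (Fin d) (Fin d) ℝ := fun x μ ν => ∑ a, minkowski a *
    (dAt W.X x (chartChange x₀ x (e μ)) a * dAt W.X x (chartChange x₀ x (e ν)) a)
  have hX (ν : Fin d) (a : Fin n) :
      ContMDiffAt (𝓡 d) 𝓘(ℝ, ℝ) ∞ (fun x => dAt W.X x (chartChange x₀ x (e ν)) a) x₀ :=
    contMDiffAt_pi_space.mp (contMDiffAt_dAt (W.smooth x₀) _) a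
  have hG₀ (μ ν : Fin d) : ContMDiffAt (𝓡 d) 𝓘(ℝ, ℝ) ∞ (fun x => G₀ x μ ν) x₀ :=
    ContMDiffAt.sum fun a _ => contMDiffAt_const.mul ((hX μ a).mul (hX ν a))
  have hG (x : S) : G₀ x = (chartMatrix x₀ x).transpose * W.gram x * chartMatrix x₀ x := by
    ext μ ν
    change inducedMetric W.X x (chartChange x₀ x (e μ)) (chartChange x₀ x (e ν)) = _
    rw [W.inducedMetric_eq]
    simp only [dotProduct, Matrix.mulVec, Matrix.mul_apply, Matrix.transpose_apply,
      Finset.mul_sum, Finset.sum_mul]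
    rw [Finset.sum_comm]
    refine Finset.sum_congr rfl fun α _ => Finset.sum_congr rfl fun β _ => ?_
    simp only [chartMatrix, e]
    ring
  have hcom {x : S} (hx : x ∈ (chartAt (EuclideanSpace ℝ (Fin d)) x₀).source) :
      W.cometric f k x = ∑ μ, ∑ ν, (((G₀ x)⁻¹ μ ν : ℝ) : ℂ) *
        (dAt f x (chartChange x₀ x (e μ)) * dAt k x (chartChange x₀ x (e ν))) := by
    have hinv : (W.gram x)⁻¹ = chartMatrix x₀ x * (G₀ x)⁻¹ * (chartMatrix x₀ x).transpose := by
      have hT : IsUnit (chartMatrix (d := d) x₀ x).det := (chartMatrix_det_ne_zero hx).isUnit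
      have hT' : IsUnit (chartMatrix (d := d) x₀ x).transpose.det := by simpa using hT
      rw [hG x, Matrix.mul_inv_rev, Matrix.mul_inv_rev]
      simp only [← Matrix.mul_assoc]
      rw [Matrix.mul_nonsing_inv _ hT, Matrix.one_mul, Matrix.mul_assoc,
        Matrix.nonsing_inv_mul _ hT', Matrix.mul_one]
    have e1 (g : S → ℂ) (ν : Fin d) : dAt g x (chartChange x₀ x (e ν)) =
        ∑ μ, (chartMatrix x₀ x μ ν : ℂ) * partialAt g x μ := by
      rw [clm_eq_sum]
      simp only [Complex.real_smul]
      rfl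
    simp only [Background.cometric, hinv, e1, Matrix.mul_apply, Matrix.transpose_apply,
      Finset.sum_mul, Finset.mul_sum, Complex.ofReal_sum, Complex.ofReal_mul]
    have swap4 (F : Fin d → Fin d → Fin d → Fin d → ℂ) :
        ∑ μ, ∑ ν, ∑ β, ∑ α, F μ ν β α = ∑ α, ∑ β, ∑ ν, ∑ μ, F μ ν β α := by
      rw [Finset.sum_comm]
      conv_lhs => enter [2, ν]; rw [Finset.sum_comm]
      rw [Finset.sum_comm]
      conv_lhs => enter [2, β, 2, ν]; rw [Finset.sum_comm]
      conv_lhs => enter [2, β]; rw [Finset.sum_comm]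
      rw [Finset.sum_comm]
    rw [swap4]
    refine Finset.sum_congr rfl fun α _ => Finset.sum_congr rfl fun β _ => ?_
    refine Finset.sum_congr rfl fun α _ => Finset.sum_congr rfl fun β _ => ?_
    ring
  have hnear : W.cometric f k =ᶠ[nhds x₀] fun x => ∑ μ, ∑ ν, (((G₀ x)⁻¹ μ ν : ℝ) : ℂ) *
        (dAt f x (chartChange x₀ x (e μ)) * dAt k x (chartChange x₀ x (e ν))) := by
    filter_upwards [(chartAt (EuclideanSpace ℝ (Fin d)) x₀).open_source.mem_nhds
      (mem_chart_source _ x₀)] with x hx using hcom hx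
  refine ContMDiffAt.congr_of_eventuallyEq ?_ hnear
  have h0 : (G₀ x₀).det ≠ 0 := by
    rw [hG, Matrix.det_mul, Matrix.det_mul, Matrix.det_transpose]
    have := chartMatrix_det_ne_zero (mem_chart_source (EuclideanSpace ℝ (Fin d)) x₀)
    exact mul_ne_zero (mul_ne_zero this (W.gram_det_ne_zero x₀)) this
  refine ContMDiffAt.sum fun μ _ => ContMDiffAt.sum fun ν _ => contMDiffAt_mul ?_
    (contMDiffAt_mul (contMDiffAt_dAt (hf x₀) _) (contMDiffAt_dAt (hk x₀) _))
  exact Complex.ofRealCLM.contDiff.contMDiff.contMDiffAt.comp x₀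
    (contMDiffAt_matrix_inv hG₀ h0 μ ν)

/-- The algebra `A = C^∞(S, ℂ)` of smooth complex functions. -/
def smoothFunctions (d : ℕ) (S : Type*) [TopologicalSpace S]
    [ChartedSpace (EuclideanSpace ℝ (Fin d)) S] : Subalgebra ℂ (S → ℂ) where
  carrier := {f | ContMDiff (𝓡 d) 𝓘(ℝ, ℂ) ∞ f}
  mul_mem' hf hg := fun x => contMDiffAt_mul (hf x) (hg x)
  add_mem' hf hg := hf.add hg
  algebraMap_mem' _ := contMDiff_const

end Geometry

section Fields

variable (d : ℕ) (S : Type*) [TopologicalSpace S] [ChartedSpace (EuclideanSpace ℝ (Fin d)) S]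

/-- Smooth complex functions on `S`. -/
def Fn : Type _ := smoothFunctions d S

instance : CommRing (Fn d S) := inferInstanceAs (CommRing (smoothFunctions d S))

instance : Algebra ℂ (Fn d S) := inferInstanceAs (Algebra ℂ (smoothFunctions d S))

variable {d S} in
/-- Evaluation of smooth functions at a point. -/
def evalAt (x : S) : Fn d S →ₐ[ℂ] ℂ :=
  (Pi.evalAlgHom ℂ (fun _ : S => ℂ) x).comp (smoothFunctions d S).val

/-- Smooth (complexified) vector fields on `S`, as derivations of the algebra of smooth functions. -/
abbrev VF : Type _ := Derivation ℂ (Fn d S) (Fn d S)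

/-- Smooth (complexified) covector fields on `S`. -/
abbrev OneForm : Type _ := VF d S →ₗ[Fn d S] Fn d S

end Fields

namespace Background

variable {d : ℕ} {S : Type*} [TopologicalSpace S] [ChartedSpace (EuclideanSpace ℝ (Fin d)) S]
  {n : ℕ} (W : Background d S n)

theorem cometric_comm (f k : S → ℂ) : W.cometric f k = W.cometric k f := by
  funext x
  have hsymm : (W.gram x).transpose = W.gram x := by
    ext μ ν
    simp only [Matrix.transpose_apply, gram, inducedMetric]
    exact Finset.sum_congr rfl fun a _ => by ring
  have hinv : ∀ μ ν, (W.gram x)⁻¹ μ ν = (W.gram x)⁻¹ ν μ := by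
    intro μ ν
    rw [← Matrix.transpose_apply (W.gram x)⁻¹, Matrix.transpose_nonsing_inv, hsymm]
  simp only [cometric]
  rw [Finset.sum_comm]
  refine Finset.sum_congr rfl fun ν _ => Finset.sum_congr rfl fun μ _ => ?_
  rw [hinv]
  ring

theorem cometric_add (f k l : Fn d S) (x : S) :
    W.cometric f.1 (fun y => k.1 y + l.1 y) x = W.cometric f.1 k.1 x + W.cometric f.1 l.1 x := by
  simp only [cometric, partialAt_add k.2 l.2, mul_add, Finset.sum_add_distrib]

theorem cometric_mul (f k l : Fn d S) (x : S) :
    W.cometric f.1 (fun y => k.1 y * l.1 y) x =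
      k.1 x * W.cometric f.1 l.1 x + l.1 x * W.cometric f.1 k.1 x := by
  simp only [cometric, partialAt_mul k.2 l.2, Finset.mul_sum, ← Finset.sum_add_distrib]
  refine Finset.sum_congr rfl fun μ _ => Finset.sum_congr rfl fun ν _ => ?_
  ring

theorem cometric_smul (f k : Fn d S) (c : ℂ) (x : S) :
    W.cometric f.1 (fun y => c * k.1 y) x = c * W.cometric f.1 k.1 x := by
  have h := W.cometric_mul f (algebraMap ℂ (Fn d S) c) k x
  have h0 : W.cometric f.1 (algebraMap ℂ (Fn d S) c).1 x = 0 := by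
    have : ∀ μ, partialAt (algebraMap ℂ (Fn d S) c).1 x μ = 0 := partialAt_const (d := d) c x
    simp only [cometric, this, mul_zero, Finset.sum_const_zero]
  rw [h0, mul_zero, add_zero] at h
  exact h

/-- The coordinate function `X^a`. -/
def coord (a : Fin n) : Fn d S :=
  ⟨fun x => (W.X x a : ℂ), Complex.ofRealCLM.contDiff.contMDiff.comp
    ((contMDiff_pi_space.mp W.smooth) a)⟩

variable [IsManifold (𝓡 d) ∞ S]

/-- The function `g^μν ∂_μ f ∂_ν k`. -/
def pairing (f k : Fn d S) : Fn d S := ⟨W.cometric f.1 k.1, W.contMDiff_cometric f.2 k.2⟩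

theorem pairing_comm (f k : Fn d S) : W.pairing f k = W.pairing k f :=
  Subtype.ext (W.cometric_comm f.1 k.1)

theorem pairing_add (f k l : Fn d S) : W.pairing f (k + l) = W.pairing f k + W.pairing f l :=
  Subtype.ext (funext fun x => W.cometric_add f k l x)

theorem pairing_smul (f k : Fn d S) (c : ℂ) : W.pairing f (c • k) = c • W.pairing f k :=
  Subtype.ext (funext fun x => W.cometric_smul f k c x)

theorem pairing_mul (f k l : Fn d S) :
    W.pairing f (k * l) = k * W.pairing f l + l * W.pairing f k :=
  Subtype.ext (funext fun x => W.cometric_mul f k l x)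

/-- The gradient vector field `(grad f)^μ = g^μν ∂_ν f` with respect to the induced metric. -/
def grad : Fn d S →ₗ[ℂ] VF d S where
  toFun f := Derivation.mk'
    { toFun := fun k => W.pairing f k
      map_add' := W.pairing_add f
      map_smul' := fun c k => W.pairing_smul f k c } (W.pairing_mul f)
  map_add' f k := by
    ext1 l
    change W.pairing (f + k) l = W.pairing f l + W.pairing k l
    rw [W.pairing_comm, W.pairing_add, W.pairing_comm l, W.pairing_comm l]
  map_smul' c f := by
    ext1 l
    change W.pairing (c • f) l = c • W.pairing f l
    rw [W.pairing_comm, W.pairing_smul, W.pairing_comm l]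

/-- The differential `dX` on vector fields, `(dX v)^a = v^μ ∂_μ X^a`. -/
def dX : VF d S →ₗ[Fn d S] (Fin n → Fn d S) where
  toFun v a := v (W.coord a)
  map_add' _ _ := rfl
  map_smul' _ _ := rfl

/-- The transpose of `dX`, `ψ_a ↦ ∂_μ X^a ψ_a`. -/
def dXT : (Fin n → Fn d S) →ₗ[Fn d S] OneForm d S where
  toFun ψ :=
    { toFun := fun v => ∑ a, v (W.coord a) * ψ a
      map_add' := fun v w => by simp [add_mul, Finset.sum_add_distrib]
      map_smul' := fun f v => by simp [mul_assoc, Finset.mul_sum] }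
  map_add' ψ χ := by ext1 v; simp [mul_add, Finset.sum_add_distrib]
  map_smul' f ψ := by ext1 v; simp [mul_left_comm, Finset.mul_sum]

/-- Lowering of a target index with the Minkowski metric. -/
def lower : (Fin n → Fn d S) →ₗ[ℂ] (Fin n → Fn d S) where
  toFun φ a := (minkowski a : ℂ) • φ a
  map_add' φ χ := by ext1 a; simp
  map_smul' c φ := by ext1 a; exact smul_comm (minkowski a : ℂ) c (φ a)

/-- `g^μν h_ab ∂_μ X^a ∂_ν φ^b`, half the trace of the variation
`η_μν = h_ab (∂_μ X^a ∂_ν φ^b + ∂_ν X^a ∂_μ φ^b)` of the induced metric under `X ↦ X + φ`. -/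
def tangentialDiv : (Fin n → Fn d S) →ₗ[ℂ] Fn d S where
  toFun φ := ∑ a, (minkowski a : ℂ) • W.grad (W.coord a) (φ a)
  map_add' φ χ := by simp only [Pi.add_apply, map_add, smul_add, Finset.sum_add_distrib]
  map_smul' c φ := by
    simp only [Pi.smul_apply, Derivation.map_smul, RingHom.id_apply, Finset.smul_sum]
    exact Finset.sum_congr rfl fun a _ => smul_comm _ _ _

/-- The divergence of a vector field with respect to the induced metric: the trace of `∇ v`, where
`∇_u v` is the tangential part of the derivative of `dX v` along `u`; in coordinates
`∇_μ v^μ = g^μν h_ab ∂_μ X^a ∂_ν (v^λ ∂_λ X^b) = (1 / √-g) ∂_μ (√-g v^μ)`. -/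
def div : VF d S →ₗ[ℂ] Fn d S := W.tangentialDiv ∘ₗ (W.dX.restrictScalars ℂ)

/-- The d'Alembertian `∇^μ ∂_μ` of the induced metric on functions. -/
def box : Fn d S →ₗ[ℂ] Fn d S := W.div ∘ₗ W.grad

/-- The Euler-Lagrange equations `∂_μ (√-g g^μν ∂_ν X^a) = 0`. -/
def IsOnShell : Prop := ∀ a, W.box (W.coord a) = 0

/-- The d'Alembertian on `ℝ^n`-valued functions, componentwise. -/
def boxVec : (Fin n → Fn d S) →ₗ[ℂ] (Fin n → Fn d S) where
  toFun φ a := W.box (φ a)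
  map_add' φ χ := by ext1 a; simp
  map_smul' c φ := by ext1 a; simp

/-- The first variation under `X ↦ X + φ` of the vector density `√-g g^μν ∂_ν X^a`, divided by
`√-g`: this is `g^μν ∂_ν φ^a + (½ g^μν tr η - η^μν) ∂_ν X^a`, where
`η_μν = h_bb (∂_μ X^b ∂_ν φ^b + ∂_ν X^b ∂_μ φ^b)` (summed over `b`). -/
def currentVariation (a : Fin n) : (Fin n → Fn d S) →ₗ[ℂ] VF d S where
  toFun φ := W.grad (φ a) + W.tangentialDiv φ • W.grad (W.coord a) -
    ∑ b, (minkowski b : ℂ) • (W.grad (W.coord a) (φ b) • W.grad (W.coord b) +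
      W.grad (W.coord a) (W.coord b) • W.grad (φ b))
  map_add' φ χ := by
    simp only [Pi.add_apply, map_add, add_smul, smul_add, Finset.sum_add_distrib]
    abel
  map_smul' c φ := by
    have h (b : Fin n) : (minkowski b : ℂ) • (W.grad (W.coord a) ((c • φ) b) • W.grad (W.coord b) +
        W.grad (W.coord a) (W.coord b) • W.grad ((c • φ) b)) =
        c • ((minkowski b : ℂ) • (W.grad (W.coord a) (φ b) • W.grad (W.coord b) +
          W.grad (W.coord a) (W.coord b) • W.grad (φ b))) := by
      rw [smul_comm c, Pi.smul_apply, Derivation.map_smul, map_smul, smul_add c, smul_assoc,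
        smul_comm _ c (W.grad (φ b))]
    rw [Finset.sum_congr rfl fun b _ => h b, ← Finset.smul_sum, map_smul, Pi.smul_apply, map_smul,
      smul_assoc, ← smul_add, RingHom.id_apply]
    ext1 l
    simp only [Derivation.sub_apply, Derivation.smul_apply, smul_sub]

/-- The linearization around `X` of `(1 / √-g) ∂_μ (√-g g^μν ∂_ν X^a)`. -/
def linearizedEOM : (Fin n → Fn d S) →ₗ[ℂ] (Fin n → Fn d S) where
  toFun φ a := W.div (W.currentVariation a φ)
  map_add' φ χ := by ext1 a; simp
  map_smul' c φ := by ext1 a; simp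

end Background

section Complex

/-- The generators of the algebra: the fields `Φ, C, C̄, B` and their antifields. -/
inductive Gen
  | Phi | C | Cbar | B | PhiStar | CStar | CbarStar | BStar
  deriving DecidableEq

namespace Gen

instance : Fintype Gen where
  elems := {Phi, C, Cbar, B, PhiStar, CStar, CbarStar, BStar}
  complete t := by cases t <;> decide

/-- The ghost number of a generator; generators of odd ghost number anticommute. -/
def gh : Gen → ℤ
  | Phi => 0
  | C => 1
  | Cbar => -1
  | B => 0
  | PhiStar => -1
  | CStar => -2
  | CbarStar => 0
  | BStar => -1

end Gen

variable (d : ℕ) (S : Type*) [TopologicalSpace S] [ChartedSpace (EuclideanSpace ℝ (Fin d)) S]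

/-- Configurations of all fields and antifields, in the order `Φ^a, C^μ, C̄^μ, B^μ, Φ‡_a, C‡_μ, C̄‡_μ,
B‡_μ`. The generators are the coordinates on this space. -/
abbrev Config (n : ℕ) : Type _ :=
  (Fin n → Fn d S) × VF d S × VF d S × VF d S ×
    (Fin n → Fn d S) × OneForm d S × OneForm d S × OneForm d S

variable {d S} {n : ℕ}

/-- The projection of a configuration to its component of type `t` (the others are set to `0`). -/
def component (t : Gen) : Config d S n →ₗ[Fn d S] Config d S n where
  toFun ψ := (if t = .Phi then ψ.1 else 0, if t = .C then ψ.2.1 else 0,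
    if t = .Cbar then ψ.2.2.1 else 0, if t = .B then ψ.2.2.2.1 else 0,
    if t = .PhiStar then ψ.2.2.2.2.1 else 0, if t = .CStar then ψ.2.2.2.2.2.1 else 0,
    if t = .CbarStar then ψ.2.2.2.2.2.2.1 else 0, if t = .BStar then ψ.2.2.2.2.2.2.2 else 0)
  map_add' ψ χ := by cases t <;> simp
  map_smul' f ψ := by cases t <;> simp

/-- The parity involution: multiplication by `(-1)^gh` on every component. -/
def parity : Config d S n →ₗ[Fn d S] Config d S n :=
  ∑ t : Gen, ((t.gh.negOnePow : ℤˣ) : ℤ) • component t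

variable (d S) in
/-- Functions of `p` vector fields with values in the smooth functions. -/
abbrev Cochain (p : ℕ) : Type _ := (Fin p → VF d S) → Fn d S

variable (d S) in
/-- The differential `p`-forms on `S` (with complex coefficients): the alternating
`C^∞(S)`-multilinear functions of `p` vector fields. -/
def diffForms (p : ℕ) : Submodule ℂ (Cochain d S p) where
  carrier := {F | ∃ η : VF d S [⋀^Fin p]→ₗ[Fn d S] Fn d S, ∀ v, η v = F v}
  add_mem' := by
    rintro F χ ⟨η, hη⟩ ⟨θ, hθ⟩
    exact ⟨η + θ, fun v => by simp [hη, hθ]⟩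
  zero_mem' := ⟨0, fun v => rfl⟩
  smul_mem' := by
    rintro c F ⟨η, hη⟩
    refine ⟨algebraMap ℂ (Fn d S) c • η, fun v => ?_⟩
    rw [AlternatingMap.smul_apply, hη, algebraMap_smul, Pi.smul_apply]

variable (d S) in
/-- The exterior derivative,
`dF(v_0, …, v_p) = ∑_j (-1)^j v_j F(…, v̂_j, …) + ∑_{i<j} (-1)^j F(…, [v_i, v_j], …, v̂_j, …)`,
the bracket standing at the `i`-th place. -/
def extd (p : ℕ) : Cochain d S p →ₗ[ℂ] Cochain d S (p + 1) where
  toFun F v := ∑ j : Fin (p + 1), (-1 : Fn d S) ^ (j : ℕ) *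
    (v j (F fun m => v (j.succAbove m)) +
      ∑ i : Fin (p + 1), if i < j then
        F fun m => Function.update v i ⁅v i, v j⁆ (j.succAbove m) else 0)
  map_add' F χ := by
    funext v
    simp only [Pi.add_apply, map_add, ← Finset.sum_add_distrib]
    refine Finset.sum_congr rfl fun j _ => ?_
    rw [← mul_add]
    congr 1
    rw [add_add_add_comm, ← Finset.sum_add_distrib]
    congr 1
    refine Finset.sum_congr rfl fun i _ => ?_
    split_ifs <;> simp
  map_smul' c F := by
    funext v
    simp only [Pi.smul_apply, Derivation.map_smul, RingHom.id_apply, Finset.smul_sum]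
    refine Finset.sum_congr rfl fun j _ => ?_
    rw [← mul_smul_comm, smul_add, Finset.smul_sum]
    congr 2
    refine Finset.sum_congr rfl fun i _ => ?_
    split_ifs <;> simp

/-- `F` is a differential operator of finite order in each argument: for some `r`, the form
`F(ψ_1, …, ψ_k)` vanishes at `x` whenever the `r`-jet at `x` of one of the `ψ_i` vanishes. -/
def IsLocal {p k : ℕ} (F : MultilinearMap ℂ (fun _ : Fin k => Config d S n) (Cochain d S p)) :
    Prop :=
  ∃ r : ℕ, ∀ (x : S) (f : Fn d S), f ∈ RingHom.ker (evalAt (d := d) x) ^ (r + 1) →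
    ∀ (ψ : Fin k → Config d S n) (i : Fin k) (v : Fin p → VF d S),
      evalAt x (F (Function.update ψ i (f • ψ i)) v) = 0

/-- Graded symmetry: exchanging two neighbouring arguments of types `s` and `t` gives the sign
`(-1)^(gh s * gh t)`. -/
def IsGradedSymmetric {p k : ℕ}
    (F : MultilinearMap ℂ (fun _ : Fin k => Config d S n) (Cochain d S p)) : Prop :=
  ∀ (i j : Fin k), (j : ℕ) = i + 1 → ∀ (s t : Gen) (ψ : Fin k → Config d S n),
    component s (ψ i) = ψ i → component t (ψ j) = ψ j →
      F (ψ ∘ Equiv.swap i j) = (((s.gh * t.gh).negOnePow : ℤˣ) : ℤ) • F ψ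

/-- `F` has ghost number `g`: it vanishes on arguments whose types have a total ghost number
different from `g`. -/
def HasGhostNumber (g : ℤ) {p k : ℕ}
    (F : MultilinearMap ℂ (fun _ : Fin k => Config d S n) (Cochain d S p)) : Prop :=
  ∀ (τ : Fin k → Gen) (ψ : Fin k → Config d S n), (∀ i, component (τ i) (ψ i) = ψ i) →
    ∑ i, (τ i).gh ≠ g → F ψ = 0

variable (d S n) in
/-- Sequences of `k`-linear functionals of the configurations, for `k = 0, 1, 2, …`. -/
def Functional (p : ℕ) : Type _ :=
  ∀ k : ℕ, MultilinearMap ℂ (fun _ : Fin k => Config d S n) (Cochain d S p)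

instance (p : ℕ) : AddCommGroup (Functional d S n p) := inferInstanceAs
  (AddCommGroup (∀ k : ℕ, MultilinearMap ℂ (fun _ : Fin k => Config d S n) (Cochain d S p)))

instance (p : ℕ) : Module ℂ (Functional d S n p) := inferInstanceAs
  (Module ℂ (∀ k : ℕ, MultilinearMap ℂ (fun _ : Fin k => Config d S n) (Cochain d S p)))

theorem Functional.add_apply {p : ℕ} (F χ : Functional d S n p) (k : ℕ) :
    (F + χ) k = F k + χ k := rfl

theorem Functional.smul_apply {p : ℕ} (c : ℂ) (F : Functional d S n p) (k : ℕ) :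
    (c • F) k = c • F k := rfl

variable (d S n) in
/-- The space of local `p`-forms of ghost number `g`: polynomials in the generators and their
derivatives with values in the differential `p`-forms on `S`. The homogeneous part of polynomial
degree `k` is given by its graded symmetric `k`-linear kernel. -/
def localForms (g : ℤ) (p : ℕ) : Submodule ℂ (Functional d S n p) where
  carrier := {F | (∃ K : ℕ, ∀ k, K < k → F k = 0) ∧ ∀ k, (∀ ψ, F k ψ ∈ diffForms d S p) ∧
    IsLocal (F k) ∧ IsGradedSymmetric (F k) ∧ HasGhostNumber g (F k)}
  add_mem' := by
    rintro F χ ⟨⟨K, hK⟩, h⟩ ⟨⟨K', hK'⟩, h'⟩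
    refine ⟨⟨max K K', fun k hk => ?_⟩, fun k => ⟨fun ψ => ?_, ?_, ?_, ?_⟩⟩
    · rw [Functional.add_apply, hK k (lt_of_le_of_lt (le_max_left _ _) hk),
        hK' k (lt_of_le_of_lt (le_max_right _ _) hk), add_zero]
    · exact (diffForms d S p).add_mem ((h k).1 ψ) ((h' k).1 ψ)
    · obtain ⟨r, hr⟩ := (h k).2.1
      obtain ⟨r', hr'⟩ := (h' k).2.1
      refine ⟨max r r', fun x f hf ψ i v => ?_⟩
      have h1 := hr x f (Ideal.pow_le_pow_right (by omega) hf) ψ i v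
      have h2 := hr' x f (Ideal.pow_le_pow_right (by omega) hf) ψ i v
      rw [Functional.add_apply, _root_.add_apply, Pi.add_apply, map_add, h1, h2, add_zero]
    · intro i j hij s t ψ hs ht
      rw [Functional.add_apply, _root_.add_apply, _root_.add_apply,
        (h k).2.2.1 i j hij s t ψ hs ht, (h' k).2.2.1 i j hij s t ψ hs ht, smul_add]
    · intro τ ψ hτ hg
      rw [Functional.add_apply, _root_.add_apply, (h k).2.2.2 τ ψ hτ hg,
        (h' k).2.2.2 τ ψ hτ hg, add_zero]
  zero_mem' := by
    refine ⟨⟨0, fun k _ => rfl⟩, fun k => ⟨fun ψ => (diffForms d S p).zero_mem, ⟨0, ?_⟩, ?_, ?_⟩⟩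
    · intro x f _ ψ i v
      exact map_zero _
    · intro i j _ s t ψ _ _
      exact (smul_zero _).symm
    · intro τ ψ _ _
      rfl
  smul_mem' := by
    rintro c F ⟨⟨K, hK⟩, h⟩
    refine ⟨⟨K, fun k hk => ?_⟩, fun k => ⟨fun ψ => ?_, ?_, ?_, ?_⟩⟩
    · rw [Functional.smul_apply, hK k hk, smul_zero]
    · exact (diffForms d S p).smul_mem c ((h k).1 ψ)
    · obtain ⟨r, hr⟩ := (h k).2.1
      refine ⟨r, fun x f hf ψ i v => ?_⟩
      rw [Functional.smul_apply, _root_.smul_apply, Pi.smul_apply, map_smul, hr x f hf ψ i v,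
        smul_zero]
    · intro i j hij s t ψ hs ht
      rw [Functional.smul_apply, _root_.smul_apply, _root_.smul_apply,
        (h k).2.2.1 i j hij s t ψ hs ht, smul_comm]
    · intro τ ψ hτ hg
      rw [Functional.smul_apply, _root_.smul_apply, (h k).2.2.2 τ ψ hτ hg, smul_zero]

variable (d S n) in
/-- The horizontal differential `d` on local forms: the exterior derivative of the value. -/
def hd (p : ℕ) : Functional d S n p →ₗ[ℂ] Functional d S n (p + 1) where
  toFun F k := (extd d S p).compMultilinearMap (F k)
  map_add' F χ := by
    funext k
    exact MultilinearMap.ext fun ψ => map_add (extd d S p) (F k ψ) (χ k ψ)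
  map_smul' c F := by
    funext k
    exact MultilinearMap.ext fun ψ => map_smul (extd d S p) c (F k ψ)

end Complex

namespace Background

variable {d : ℕ} {S : Type*} [TopologicalSpace S] [ChartedSpace (EuclideanSpace ℝ (Fin d)) S]
  [IsManifold (𝓡 d) ∞ S] {n : ℕ} (W : Background d S n) (ζ : ℝ)

/-- The action of `s_0` on the generators, as a linear differential operator `D` on configurations:
`(s_0 F)(ψ) = F(D ψ)` for every generator `F`. In the order `Φ, C, C̄, B, Φ‡, C‡, C̄‡, B‡`. -/
def freeBV : Config d S n →ₗ[ℂ] Config d S n where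
  toFun := fun ⟨Φ, C, Cbar, B, Φs, Cs, Cbars, Bs⟩ =>
    (W.dX C,
      0,
      Complex.I • B,
      0,
      -lower (W.linearizedEOM Φ) - (ζ : ℂ) • lower (W.boxVec (W.dX B)),
      W.dXT (Φs - ((ζ : ℂ) * Complex.I) • lower (W.boxVec (W.dX Cbar))),
      W.dXT (((ζ : ℂ) * Complex.I) • lower (W.boxVec (W.dX C))),
      -(Complex.I • Cbars) - W.dXT ((ζ : ℂ) • lower (W.boxVec Φ)))
  map_add' := by
    rintro ⟨Φ, C, Cbar, B, Φs, Cs, Cbars, Bs⟩ ⟨Φ', C', Cbar', B', Φs', Cs', Cbars', Bs'⟩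
    simp only [Prod.mk_add_mk, map_add, map_sub, smul_add, Prod.mk.injEq, add_zero, true_and]
    exact ⟨by abel, by abel, by abel⟩
  map_smul' := by
    rintro c ⟨Φ, C, Cbar, B, Φs, Cs, Cbars, Bs⟩
    have hT (c : ℂ) (χ : Fin n → Fn d S) : dXT W (c • χ) = c • W.dXT χ :=
      (W.dXT.restrictScalars ℂ).map_smul c χ
    have hX (v : VF d S) : W.dX (c • v) = c • W.dX v := (W.dX.restrictScalars ℂ).map_smul c v
    simp only [Prod.smul_mk, Prod.mk.injEq, map_smul, map_sub, hT, hX, smul_zero, true_and,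
      RingHom.id_apply, smul_sub, smul_neg]
    simp only [smul_comm c, and_self]

/-- The free BV differential `s_0` on functionals, the graded derivation
`(s_0 F)(ψ_1, …, ψ_k) = ∑_i ± F(ψ_1, …, D ψ_i, …, ψ_k)`; the sign is `(-1)^(gh ψ_1 + … + gh ψ_{i-1})`. -/
def s₀ (p : ℕ) : Functional d S n p →ₗ[ℂ] Functional d S n p where
  toFun F k := ∑ i : Fin k, (F k).compLinearMap fun j =>
    if j < i then (parity (d := d) (S := S) (n := n)).restrictScalars ℂ
    else if j = i then W.freeBV ζ else LinearMap.id
  map_add' F χ := by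
    funext k
    refine Eq.trans ?_ Finset.sum_add_distrib
    exact Finset.sum_congr rfl fun i _ => MultilinearMap.ext fun ψ => rfl
  map_smul' c F := by
    funext k
    change _ = c • (∑ i : Fin k, _ :
      MultilinearMap ℂ (fun _ : Fin k => Config d S n) (Cochain d S p))
    rw [Finset.smul_sum]
    exact Finset.sum_congr rfl fun i _ => MultilinearMap.ext fun ψ => rfl

/-- The local `p`-forms of ghost number `g` that are `d` of a local `(p-1)`-form. -/
def dExact (g : ℤ) : (p : ℕ) → Submodule ℂ (Functional d S n p)
  | 0 => ⊥
  | p + 1 => (localForms d S n g p).map (hd d S n p)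

/-- The cocycles of `s_0` in local `p`-forms of ghost number `g`. -/
def cocycles (g : ℤ) (p : ℕ) : Submodule ℂ (Functional d S n p) :=
  localForms d S n g p ⊓ LinearMap.ker (W.s₀ ζ p)

/-- The coboundaries of `s_0` in local `p`-forms of ghost number `g`. -/
def coboundaries (g : ℤ) (p : ℕ) : Submodule ℂ (Functional d S n p) :=
  (localForms d S n (g - 1) p).map (W.s₀ ζ p)

/-- The cohomology `H(s_0)` at ghost number `g` and form degree `p`. -/
abbrev H (g : ℤ) (p : ℕ) : Type _ :=
  W.cocycles ζ g p ⧸ (W.coboundaries ζ g p).submoduleOf (W.cocycles ζ g p)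

/-- The relative cocycles: local `p`-forms `F` of ghost number `g` with `s_0 F + d G = 0` for a
local `(p-1)`-form `G` of ghost number `g + 1`. -/
def relCocycles (g : ℤ) (p : ℕ) : Submodule ℂ (Functional d S n p) :=
  localForms d S n g p ⊓ (dExact (g + 1) p).comap (W.s₀ ζ p)

/-- The relative coboundaries `s_0 F' + d G'`. -/
def relCoboundaries (g : ℤ) (p : ℕ) : Submodule ℂ (Functional d S n p) :=
  W.coboundaries ζ g p ⊔ dExact g p

/-- The relative cohomology `H(s_0|d)` at ghost number `g` and form degree `p`. -/
abbrev HRel (g : ℤ) (p : ℕ) : Type _ :=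
  W.relCocycles ζ g p ⧸ (W.relCoboundaries ζ g p).submoduleOf (W.relCocycles ζ g p)

end Background

end NambuGoto
end

/-!
The free BV complex is contractible at positive ghost number because the ghost `C` is the only
generator of positive ghost number, and `s_0` pairs it with the tangential part of the fluctuation,
`s_0 Φ = dX C`. All differentials act through the arguments of the multilinear kernels: `s_0` is the
odd derivation induced by the operator `D = freeBV` on configurations, while `d` acts on the values
only, and so commutes with everything that is done to the arguments.

Let `h = ghostHomotopy` move the tangential part of `Φ` into `C`, and let `N = D h + h D`
(`gaugeProj`). Then `N` is a projection that commutes with `D`, and a configuration in the kernel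
of `N` has no ghost component. The odd derivation `κ` induced by `h` satisfies
`s_0 κ + κ s_0 = N_*`, the derivation induced by `N` (`oddDerivation_anticomm`). Expanding every
argument as `ψ = N ψ + (1 - N) ψ` diagonalizes `N_*`: the part of a kernel with `N` in exactly `j`
places has eigenvalue `j`. At positive ghost number the part with `j = 0` vanishes, so that `N_*`
has the inverse `T` (`invNumber`), which commutes with `s_0` and preserves local forms. Hence
`F = s_0 κ T F + κ T s_0 F` for every local form `F` of positive ghost number (`s₀_homotopy`). If
`s_0 F = 0`, this exhibits `F` as a coboundary; if `s_0 F = -d G`, then `κ T s_0 F = -d κ T G`,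
which gives the relative statement without any appeal to the cohomology of `d`.

The geometry enters at two points. First, `dX` has a `C^∞`-linear left inverse on vector fields
(`tangentialPart_dX`). As vector fields are derivations of the algebra of functions, this requires
Hadamard's lemma, by which a derivation at a point only sees the differential of a function
(`evalAt_derivation_eq_zero`). Second, `N` commutes with `D` because tangential fluctuations solve
the linearized equations (`linearizedEOM_dX`). Here the variation of the current is its Lie
derivative, so that the variation of the equations of motion is the Lie derivative of the scalar
density `√-g □X`, which vanishes on shell. Both this and the formula for the divergence of a
commutator are derived from the algebra of the tangential projection `g^μν ∂_μ X^a ∂_ν X^b` and its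
derivatives.
-/

namespace NambuGoto

/-! ### Hadamard's lemma -/

section Hadamard

theorem hasFDerivAt_integral_zero_one {E G : Type*} [NormedAddCommGroup E] [NormedSpace ℝ E]
    [ProperSpace E] [NormedAddCommGroup G] [NormedSpace ℝ G] {F : E → ℝ → G}
    {F' : E → ℝ → E →L[ℝ] G} (hF : Continuous fun q : E × ℝ => F q.1 q.2)
    (hF' : Continuous fun q : E × ℝ => F' q.1 q.2)
    (h : ∀ y t, HasFDerivAt (fun y => F y t) (F' y t) y) (y₀ : E) :
    HasFDerivAt (fun y => ∫ t in (0 : ℝ)..1, F y t) (∫ t in (0 : ℝ)..1, F' y₀ t) y₀ := by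
  obtain ⟨B, hB⟩ := ((isCompact_closedBall y₀ 1).prod
    (isCompact_Icc (a := (0 : ℝ)) (b := 1))).bddAbove_image
    (f := fun q : E × ℝ => ‖F' q.1 q.2‖) hF'.norm.continuousOn
  have hc (y : E) : Continuous (F y) := hF.comp (by fun_prop : Continuous fun t : ℝ => (y, t))
  have hc' (y : E) : Continuous (F' y) := hF'.comp (by fun_prop : Continuous fun t : ℝ => (y, t))
  refine intervalIntegral.hasFDerivAt_integral_of_dominated_of_fderiv_le (𝕜 := ℝ)
    (bound := fun _ => B) (F' := F')
    (Metric.closedBall_mem_nhds y₀ one_pos)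
    (Filter.Eventually.of_forall fun y => (hc y).aestronglyMeasurable)
    ((hc y₀).intervalIntegrable _ _) (hc' y₀).aestronglyMeasurable
    (Filter.Eventually.of_forall fun t ht y hy => hB ⟨(y, t), ⟨hy, ?_⟩, rfl⟩)
    intervalIntegrable_const (Filter.Eventually.of_forall fun t _ y _ => h y t)
  rw [Set.uIoc_of_le zero_le_one] at ht
  exact ⟨ht.1.le, ht.2⟩

theorem contDiff_integral_zero_one {E : Type} [NormedAddCommGroup E] [NormedSpace ℝ E]
    [ProperSpace E] (m : ℕ) : ∀ {G : Type} [NormedAddCommGroup G] [NormedSpace ℝ G]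
    {F : E → ℝ → G}, ContDiff ℝ ∞ (fun q : E × ℝ => F q.1 q.2) →
    ContDiff ℝ m fun y => ∫ t in (0 : ℝ)..1, F y t := by
  induction m with
  | zero =>
    intro G _ _ F hF
    exact contDiff_zero.2 (intervalIntegral.continuous_parametric_intervalIntegral_of_continuous'
      hF.continuous 0 1)
  | succ m ih =>
    intro G _ _ F hF
    have hF' : ContDiff ℝ ∞ fun q : E × ℝ => (fderiv ℝ (fun q : E × ℝ => F q.1 q.2) q).comp
        (ContinuousLinearMap.inl ℝ E ℝ) :=
      (hF.fderiv_right (m := ∞) (by simp)).clm_comp contDiff_const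
    refine contDiff_succ_iff_hasFDerivAt.2 ⟨_, ih (F := fun y t =>
      (fderiv ℝ (fun q : E × ℝ => F q.1 q.2) (y, t)).comp (ContinuousLinearMap.inl ℝ E ℝ)) hF',
      hasFDerivAt_integral_zero_one (F' := fun y t =>
      (fderiv ℝ (fun q : E × ℝ => F q.1 q.2) (y, t)).comp (ContinuousLinearMap.inl ℝ E ℝ))
      hF.continuous hF'.continuous fun y t => ?_⟩
    exact HasFDerivAt.comp (f := fun y : E => (y, t)) y
      (hF.differentiable (by simp) (y, t)).hasFDerivAt (hasFDerivAt_prodMk_left y t)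

/-- Hadamard's lemma: a smooth function differs from its value at `y₀` by `g y (y - y₀)`, where
`g` is smooth and `g y₀` is the derivative at `y₀`. -/
theorem exists_eq_add_apply_sub {E : Type} [NormedAddCommGroup E] [NormedSpace ℝ E]
    [ProperSpace E] {u : E → ℂ} (hu : ContDiff ℝ ∞ u) (y₀ : E) :
    ∃ g : E → E →L[ℝ] ℂ, ContDiff ℝ ∞ g ∧ g y₀ = fderiv ℝ u y₀ ∧
      ∀ y, u y = u y₀ + g y (y - y₀) := by
  have hd : ContDiff ℝ ∞ (fderiv ℝ u) := hu.fderiv_right (by simp)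
  have hF : ContDiff ℝ ∞ fun q : E × ℝ => fderiv ℝ u (y₀ + q.2 • (q.1 - y₀)) :=
    hd.comp (by fun_prop)
  refine ⟨fun y => ∫ t in (0 : ℝ)..1, fderiv ℝ u (y₀ + t • (y - y₀)),
    contDiff_infty.2 fun m => contDiff_integral_zero_one m hF, by simp, fun y => ?_⟩
  have hline (t : ℝ) : HasDerivAt (fun t : ℝ => u (y₀ + t • (y - y₀)))
      (fderiv ℝ u (y₀ + t • (y - y₀)) (y - y₀)) t := by
    have h1 : HasDerivAt (fun t : ℝ => y₀ + t • (y - y₀)) (y - y₀) t := by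
      simpa using ((hasDerivAt_id t).smul_const (y - y₀)).const_add y₀
    exact ((hu.differentiable (by simp) _).hasFDerivAt).comp_hasDerivAt t h1
  have hcont : Continuous fun t : ℝ => fderiv ℝ u (y₀ + t • (y - y₀)) :=
    hd.continuous.comp (by fun_prop)
  have hint := intervalIntegral.integral_eq_sub_of_hasDerivAt (a := 0) (b := 1)
    (fun t _ => hline t)
    ((hcont.clm_apply continuous_const).intervalIntegrable _ _)
  rw [ContinuousLinearMap.intervalIntegral_apply (hcont.intervalIntegrable _ _), hint]
  simp

end Hadamard

/-! ### Derivations of the algebra of smooth functions -/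

section Locality

variable {d : ℕ} {S : Type*} [TopologicalSpace S] [ChartedSpace (EuclideanSpace ℝ (Fin d)) S]

theorem evalAt_apply (x : S) (f : Fn d S) : evalAt (d := d) x f = f.1 x := rfl

theorem Fn.ext {f k : Fn d S} (h : ∀ x : S, evalAt (d := d) x f = evalAt (d := d) x k) : f = k :=
  Subtype.ext (funext h)

variable [T2Space S] [IsManifold (𝓡 d) ∞ S]

/-- Derivations are local, of first order: a function that vanishes at `x` together with its
differential lies in the square of the ideal of functions vanishing at `x`, up to a function that
vanishes near `x`. -/
theorem evalAt_derivation_eq_zero (v : VF d S) (f : Fn d S) (x : S) (h0 : evalAt (d := d) x f = 0)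
    (hf : dAt (d := d) f.1 x = 0) : evalAt (d := d) x (v f) = 0 := by
  obtain ⟨χ⟩ : Nonempty (SmoothBumpFunction (𝓡 d) x) := inferInstance
  set φ := extChartAt (𝓡 d) x with hφ
  set b := χ.toContDiffBump with hb
  -- the chart representative of `f`, cut off to a function on the whole of `ℝ^d`
  let u : EuclideanSpace ℝ (Fin d) → ℂ := fun y => (b y : ℂ) * f.1 (φ.symm y)
  have hball : Metric.closedBall (φ x) b.rOut ⊆ φ.target := by
    simpa only [modelWithCornersSelf_coe, Set.range_id, Set.inter_univ] using χ.closedBall_subset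
  have htarget : IsOpen φ.target := isOpen_extChartAt_target x
  have hfs : ContDiffOn ℝ ∞ (fun y => f.1 (φ.symm y)) φ.target :=
    (f.2.comp_contMDiffOn (contMDiffOn_extChartAt_symm x)).contDiffOn
  have hu : ContDiff ℝ ∞ u := by
    refine contDiff_iff_contDiffAt.2 fun y => ?_
    by_cases hy : y ∈ φ.target
    · exact (Complex.ofRealCLM.contDiff.contDiffAt.comp y b.contDiffAt).mul
        ((hfs y hy).contDiffAt (htarget.mem_nhds hy))
    · refine (contDiffAt_const (c := (0 : ℂ))).congr_of_eventuallyEq ?_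
      filter_upwards [Metric.isClosed_closedBall.isOpen_compl.mem_nhds
        (fun h => hy (hball h) : y ∈ (Metric.closedBall (φ x) b.rOut)ᶜ)] with z hz
      have : b z = 0 := b.zero_of_le_dist (not_le.1 (Metric.mem_closedBall.not.1 hz)).le
      exact mul_eq_zero_of_left (congrArg Complex.ofReal this) _
  have hu0 : u (φ x) = 0 := by
    have : φ.symm (φ x) = x := extChartAt_to_inv (I := 𝓡 d) x
    have h0' : f.1 x = 0 := h0
    simp [u, this, h0']
  have hdu : fderiv ℝ u (φ x) = 0 := by
    have h1 : u =ᶠ[nhds (φ x)] fun y => f.1 (φ.symm y) := by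
      filter_upwards [b.eventuallyEq_one] with y hy
      exact (congrArg (fun r : ℝ => (r : ℂ) * f.1 (φ.symm y)) hy).trans (by simp)
    rw [h1.fderiv_eq, ← hf]
    have h2 := (f.2.mdifferentiable (by simp) x).mfderiv
    simp only [writtenInExtChartAt, extChartAt_model_space_eq_id, PartialEquiv.refl_coe,
      Function.id_comp, modelWithCornersSelf_coe,
      Set.range_id, fderivWithin_univ] at h2
    exact h2.symm
  obtain ⟨g, hg, hg0, hgu⟩ := exists_eq_add_apply_sub hu (φ x)
  have hsource : ∀ z, z ∉ (chartAt (EuclideanSpace ℝ (Fin d)) x).source → χ z = 0 := fun z hz =>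
    by_contra fun h => hz (χ.support_subset_source h)
  have hφs : ContMDiffOn (𝓡 d) 𝓘(ℝ, EuclideanSpace ℝ (Fin d)) ∞ φ
      (chartAt (EuclideanSpace ℝ (Fin d)) x).source := contMDiffOn_extChartAt
  -- cut-off functions on the manifold
  let c : Fn d S := ⟨fun z => (χ z : ℂ), Complex.ofRealCLM.contDiff.contMDiff.comp χ.contMDiff⟩
  let y (i : Fin d) : Fn d S := ⟨fun z => χ z • (((φ z - φ x) i : ℝ) : ℂ), χ.contMDiff_smul <| by
    have h : ContDiff ℝ ∞ fun w : EuclideanSpace ℝ (Fin d) =>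
        (EuclideanSpace.proj i : EuclideanSpace ℝ (Fin d) →L[ℝ] ℝ) (w - φ x) :=
      (EuclideanSpace.proj i : EuclideanSpace ℝ (Fin d) →L[ℝ] ℝ).contDiff.comp
        (contDiff_id.sub contDiff_const)
    have : ContDiff ℝ ∞ fun w : EuclideanSpace ℝ (Fin d) => (((w - φ x) i : ℝ) : ℂ) :=
      Complex.ofRealCLM.contDiff.comp h
    exact this.contMDiff.comp_contMDiffOn hφs⟩
  let k (i : Fin d) : Fn d S := ⟨fun z => χ z • g (φ z) (EuclideanSpace.single i 1),
    χ.contMDiff_smul <| by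
      have : ContDiff ℝ ∞ fun w => g w (EuclideanSpace.single i 1) :=
        hg.clm_apply contDiff_const
      exact this.contMDiff.comp_contMDiffOn hφs⟩
  -- on the chart `c f` is `u`, so that `c ^ 3 f` is a sum of products of functions vanishing at `x`
  have hdec : f = (1 - c * c * c) * f + ∑ i, y i * k i := by
    have hev (z : S) : (c.1 z * c.1 z * c.1 z) * f.1 z = ∑ i, (y i).1 z * (k i).1 z := by
      by_cases hz : z ∈ (chartAt (EuclideanSpace ℝ (Fin d)) x).source
      · have h1 : u (φ z) = c.1 z * f.1 z := by
          have h2 : φ.symm (φ z) = z := φ.left_inv (by simpa [hφ] using hz)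
          have h3 : χ z = b (φ z) := χ.eqOn_source hz
          simp only [u, h2, c, h3]
        rw [mul_assoc, ← h1, hgu, hu0, zero_add, clm_eq_sum, Finset.mul_sum]
        refine Finset.sum_congr rfl fun i _ => ?_
        simp only [c, y, k, Complex.real_smul]
        ring
      · simp [c, y, hsource z hz]
    refine Fn.ext fun z => ?_
    rw [map_add, map_mul, map_sub, map_one, map_mul, map_mul, map_sum]
    simp only [map_mul]
    simp only [evalAt_apply]
    rw [← hev]
    ring
  have hc1 : evalAt (d := d) x c = 1 := congrArg Complex.ofReal χ.eq_one
  have hy0 (i : Fin d) : evalAt (d := d) x (y i) = 0 :=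
    (congrArg (fun w : EuclideanSpace ℝ (Fin d) => χ x • ((w i : ℝ) : ℂ)) (sub_self (φ x))).trans
      (by simp)
  have hk0 (i : Fin d) : evalAt (d := d) x (k i) = 0 :=
    (congrArg (fun A : EuclideanSpace ℝ (Fin d) →L[ℝ] ℂ => χ x • A (EuclideanSpace.single i 1))
      (hg0.trans hdu)).trans (by simp)
  rw [hdec]
  simp [hc1, hy0, hk0, h0]

end Locality

/-! ### Matrix identities for projections -/

section Matrix

variable {ι R : Type*} [Fintype ι] [CommRing R] {H P U V A B : Matrix ι ι R}

open Matrix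

/-- If `P` is a projection (with respect to the metric `H`) and `U` is a derivative of it, then the
block of `U` that is tangential on both sides vanishes. -/
theorem proj_mul_deriv_mul_proj (hP : P * H * P = P) (hU : U = U * H * P + P * H * U) :
    P * H * U * H * P = 0 := by
  have h1 : P * H * U * H * P = P * H * U * H * (P * H * P) + (P * H * P) * H * U * H * P := by
    conv_lhs => rw [hU]
    noncomm_ring
  rw [hP] at h1
  have h2 : P * H * U * H * P + P * H * U * H * P = P * H * U * H * P + 0 := by
    rw [← h1, add_zero]
  exact add_left_cancel h2

/-- If the derivative `U` of the projection `P` is multiplied by a tangential matrix `A` whose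
normal part is that of `V`, the trace depends on `A` only through `V`. -/
theorem trace_deriv_mul (hP : P * H * P = P) (hU : U = U * H * P + P * H * U)
    (hA : P * H * A = A) (hAV : A - A * H * P = V - V * H * P) :
    (H * U * H * A).trace = (H * U * H * V).trace - (H * U * H * V * H * P).trace := by
  have h1 : A = P * H * A * H * P + V - V * H * P := by
    rw [hA, ← sub_eq_iff_eq_add'.2 (eq_add_of_sub_eq hAV)]
    abel
  have h2 : (H * U * H * (P * H * A * H * P)).trace = 0 := by
    have : H * U * H * (P * H * A * H * P) = (H * U * H * P * H * A) * (H * P) := by noncomm_ring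
    rw [this, trace_mul_comm]
    have : H * P * (H * U * H * P * H * A) = H * (P * H * U * H * P) * H * A := by noncomm_ring
    rw [this, proj_mul_deriv_mul_proj hP hU]
    simp
  have h3 : H * U * H * A = H * U * H * (P * H * A * H * P) + H * U * H * V
      - H * U * H * V * H * P := by
    conv_lhs => rw [h1]
    noncomm_ring
  rw [h3, trace_sub, trace_add, h2, zero_add]

/-- The symmetry that makes the divergence of a commutator of vector fields torsion free. -/
theorem trace_deriv_mul_comm (hH : Hᵀ = H) (hPt : Pᵀ = P) (hUt : Uᵀ = U) (hVt : Vᵀ = V)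
    (hP : P * H * P = P) (hU : U = U * H * P + P * H * U) (hV : V = V * H * P + P * H * V)
    (hA : P * H * A = A) (hB : P * H * B = B) (hAV : A - A * H * P = V - V * H * P)
    (hBU : B - B * H * P = U - U * H * P) :
    (H * U * H * A).trace = (H * V * H * B).trace := by
  rw [trace_deriv_mul hP hU hA hAV, trace_deriv_mul hP hV hB hBU]
  congr 1
  · rw [Matrix.mul_assoc (H * U), trace_mul_comm, ← Matrix.mul_assoc]
  · rw [← trace_transpose (H * U * H * V * H * P)]
    simp only [transpose_mul, hH, hPt, hUt, hVt]
    have h : P * (H * (V * (H * (U * H)))) = P * (H * V * H * U * H) := by noncomm_ring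
    rw [h, trace_mul_comm]

end Matrix

/-! ### The tangential projection and gauge invariance -/

namespace Background

variable {d : ℕ} {S : Type*} [TopologicalSpace S] [ChartedSpace (EuclideanSpace ℝ (Fin d)) S]
  {n : ℕ} (W : Background d S n)

/-- The partial derivative at a point as a linear functional on smooth functions. -/
noncomputable def partialLin (x : S) (μ : Fin d) : Fn d S →ₗ[ℂ] ℂ where
  toFun f := partialAt f.1 x μ
  map_add' f k := partialAt_add f.2 k.2 x μ
  map_smul' c f := by
    have h := partialAt_mul (d := d) (algebraMap ℂ (Fn d S) c).2 f.2 x μ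
    have h0 : partialAt (algebraMap ℂ (Fn d S) c).1 x μ = 0 := partialAt_const (d := d) c x μ
    rw [h0, mul_zero, add_zero] at h
    exact h

theorem partialLin_const (x : S) (μ : Fin d) (c : ℂ) :
    partialLin x μ (algebraMap ℂ (Fn d S) c) = 0 := partialAt_const (d := d) c x μ

theorem dAt_eq_zero_of_partialLin {f : Fn d S} {x : S} (h : ∀ μ, partialLin x μ f = 0) :
    dAt (d := d) f.1 x = 0 := by
  ext u
  rw [clm_eq_sum]
  exact Finset.sum_eq_zero fun μ _ => (congrArg (u μ • ·) (h μ)).trans (smul_zero _)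

theorem dAt_coord (x : S) (a : Fin n) (u : EuclideanSpace ℝ (Fin d)) :
    dAt (W.coord a).1 x u = (dAt W.X x u a : ℂ) := by
  let L : (Fin n → ℝ) →L[ℝ] ℂ := Complex.ofRealCLM.comp (ContinuousLinearMap.proj a)
  have h1 := (W.smooth.mdifferentiable (by simp) x).hasMFDerivAt
  have h2 := (L.hasMFDerivAt (x := W.X x)).comp x h1
  exact congrArg (fun A : EuclideanSpace ℝ (Fin d) →L[ℝ] ℂ => A u) h2.mfderiv

theorem gram_eq (x : S) (μ ν : Fin d) : (W.gram x μ ν : ℂ) =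
    ∑ a, (minkowski a : ℂ) * (partialAt (W.coord a).1 x μ * partialAt (W.coord a).1 x ν) := by
  simp only [gram, inducedMetric, partialAt, dAt_coord]
  push_cast
  rfl

/-- The differential of a function is the combination of the differentials of the coordinate
functions with coefficients `h_ab g(dX^b, df)`. -/
theorem partialAt_eq_sum (f : Fn d S) (x : S) (μ : Fin d) : partialAt f.1 x μ =
    ∑ a, (minkowski a : ℂ) * W.cometric (W.coord a).1 f.1 x * partialAt (W.coord a).1 x μ := by
  have hinv : ∀ l, ∑ ν, (((W.gram x)⁻¹ l ν : ℝ) : ℂ) * (W.gram x ν μ : ℂ) =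
      if l = μ then 1 else 0 := by
    intro l
    have := congrFun (congrFun
      (Matrix.nonsing_inv_mul (W.gram x) (W.gram_det_ne_zero x).isUnit) l) μ
    rw [Matrix.mul_apply, Matrix.one_apply] at this
    have h := congrArg Complex.ofReal this
    rw [Complex.ofReal_sum, apply_ite Complex.ofReal] at h
    simpa only [Complex.ofReal_mul, Complex.ofReal_one, Complex.ofReal_zero] using h
  calc partialAt f.1 x μ
      = ∑ l, partialAt f.1 x l * ∑ ν, (((W.gram x)⁻¹ l ν : ℝ) : ℂ) * (W.gram x ν μ : ℂ) := by
        simp [hinv]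
    _ = ∑ a, (minkowski a : ℂ) * W.cometric f.1 (W.coord a).1 x *
          partialAt (W.coord a).1 x μ := by
        simp only [gram_eq, cometric, Finset.mul_sum, Finset.sum_mul]
        conv_lhs => enter [2, l]; rw [Finset.sum_comm]
        rw [Finset.sum_comm]
        refine Finset.sum_congr rfl fun a _ => Finset.sum_congr rfl fun l _ =>
          Finset.sum_congr rfl fun ν _ => ?_
        ring
    _ = _ := by simp only [W.cometric_comm f.1]

/-- The diagonal matrix of the Minkowski metric, with entries in the smooth functions. -/
noncomputable def minkowskiMatrix (d : ℕ) (S : Type*) [TopologicalSpace S]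
    [ChartedSpace (EuclideanSpace ℝ (Fin d)) S] (n : ℕ) : Matrix (Fin n) (Fin n) (Fn d S) :=
  Matrix.diagonal fun a => algebraMap ℂ (Fn d S) (minkowski a : ℂ)

local notation "𝓗" => minkowskiMatrix d S n

theorem mul_minkowskiMatrix_mul (M N : Matrix (Fin n) (Fin n) (Fn d S)) (a c : Fin n) :
    (M * 𝓗 * N) a c = ∑ b, (minkowski b : ℂ) • (M a b * N b c) := by
  rw [Matrix.mul_apply]
  refine Finset.sum_congr rfl fun b _ => ?_
  rw [minkowskiMatrix, Matrix.mul_diagonal, Algebra.smul_def]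
  ring

theorem trace_minkowskiMatrix_mul (M : Matrix (Fin n) (Fin n) (Fn d S)) :
    (𝓗 * M).trace = ∑ a, (minkowski a : ℂ) • M a a := by
  simp only [Matrix.trace, Matrix.diag, minkowskiMatrix, Matrix.diagonal_mul, Algebra.smul_def]

theorem minkowskiMatrix_transpose : (𝓗).transpose = 𝓗 := Matrix.diagonal_transpose _

variable [IsManifold (𝓡 d) ∞ S]

/-- The matrix `g^μν ∂_μ X^a ∂_ν X^b`: with an index lowered it is the projection of `ℝ^n` to the
tangent space of the image of `X`. -/
noncomputable def tangentProj : Matrix (Fin n) (Fin n) (Fn d S) :=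
  fun a b => W.grad (W.coord a) (W.coord b)

/-- The matrix `g^μν ∂_μ X^a ∂_ν (v X^b)` of the derivatives of `dX v`. -/
noncomputable def derivMatrix (v : VF d S) : Matrix (Fin n) (Fin n) (Fn d S) :=
  fun a b => W.grad (W.coord a) (v (W.coord b))

theorem tangentProj_transpose : W.tangentProj.transpose = W.tangentProj := by
  ext1 a b
  exact W.pairing_comm (W.coord b) (W.coord a)

theorem map_tangentProj_transpose (v : VF d S) :
    (W.tangentProj.map v).transpose = W.tangentProj.map v := by
  rw [← Matrix.transpose_map, tangentProj_transpose]

theorem div_apply (v : VF d S) :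
    W.div v = ∑ a, (minkowski a : ℂ) • W.grad (W.coord a) (v (W.coord a)) := rfl

variable [T2Space S]

/-- Completeness: every vector field is tangent to the image of `X`, and is determined by its
action on the coordinate functions, `v = h_ab v(X^a) grad X^b`. -/
theorem derivation_apply (v : VF d S) (f : Fn d S) :
    v f = ∑ a, (minkowski a : ℂ) • (v (W.coord a) * W.grad (W.coord a) f) := by
  refine Fn.ext fun x => ?_
  let c (a : Fin n) : ℂ := (minkowski a : ℂ) * W.cometric (W.coord a).1 f.1 x
  -- `k` has zero differential at `x`; subtracting its value there makes it vanish to second order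
  let k : Fn d S := f - ∑ a, c a • W.coord a
  let k₀ : Fn d S := k - algebraMap ℂ (Fn d S) (evalAt (d := d) x k)
  have hk₀ : dAt (d := d) k₀.1 x = 0 := by
    refine dAt_eq_zero_of_partialLin fun μ => ?_
    simp only [k₀, k, map_sub, map_sum, map_smul, smul_eq_mul, partialLin_const,
      Finset.sum_const_zero, sub_zero]
    exact sub_eq_zero.2 (W.partialAt_eq_sum f x μ)
  have h := evalAt_derivation_eq_zero v k₀ x (by
    simp only [k₀, map_sub, AlgHom.commutes]; exact sub_self _) hk₀
  simp only [k₀, k, map_sub, map_sum, Derivation.map_smul, Derivation.map_algebraMap,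
    map_smul, Finset.sum_const_zero, sub_zero, sub_eq_zero, smul_eq_mul] at h
  rw [h, map_sum]
  refine Finset.sum_congr rfl fun a _ => ?_
  rw [map_smul, map_mul, smul_eq_mul]
  change c a * _ = _ * (_ * W.cometric (W.coord a).1 f.1 x)
  simp only [c]
  ring

theorem vf_ext {v w : VF d S} (h : ∀ a, v (W.coord a) = w (W.coord a)) : v = w := by
  ext1 f
  rw [W.derivation_apply v, W.derivation_apply w]
  simp only [h]

theorem mul_tangentProj (v : VF d S) (b : Fin n) :
    ∑ a, (minkowski a : ℂ) • (v (W.coord a) * W.tangentProj a b) = v (W.coord b) :=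
  (W.derivation_apply v (W.coord b)).symm

theorem tangentProj_mul_derivMatrix (v : VF d S) :
    W.tangentProj * 𝓗 * W.derivMatrix v = W.derivMatrix v := by
  ext1 a c
  rw [mul_minkowskiMatrix_mul]
  exact (W.derivation_apply (W.grad (W.coord a)) (v (W.coord c))).symm

theorem tangentProj_mul_self : W.tangentProj * 𝓗 * W.tangentProj = W.tangentProj := by
  ext1 a c
  rw [mul_minkowskiMatrix_mul]
  exact W.mul_tangentProj (W.grad (W.coord a)) c

theorem map_tangentProj (v : VF d S) : W.tangentProj.map v =
    W.tangentProj.map v * 𝓗 * W.tangentProj + W.tangentProj * 𝓗 * W.tangentProj.map v := by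
  ext1 a c
  have h : W.tangentProj a c =
      ∑ b, (minkowski b : ℂ) • (W.tangentProj a b * W.tangentProj b c) := by
    rw [← mul_minkowskiMatrix_mul, tangentProj_mul_self]
  rw [Matrix.add_apply, mul_minkowskiMatrix_mul, mul_minkowskiMatrix_mul, Matrix.map_apply, h,
    map_sum, ← Finset.sum_add_distrib]
  refine Finset.sum_congr rfl fun b _ => ?_
  rw [Derivation.map_smul, Derivation.leibniz, ← smul_add, Matrix.map_apply, Matrix.map_apply,
    smul_eq_mul, smul_eq_mul]
  congr 1
  ring

/-- The normal parts of `∂ (dX v)` and `v (dX)` agree, because `[grad X^a, v]` is tangential. -/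
theorem derivMatrix_sub (v : VF d S) : W.derivMatrix v - W.derivMatrix v * 𝓗 * W.tangentProj =
    W.tangentProj.map v - W.tangentProj.map v * 𝓗 * W.tangentProj := by
  have h : W.derivMatrix v - W.tangentProj.map v =
      (W.derivMatrix v - W.tangentProj.map v) * 𝓗 * W.tangentProj := by
    ext1 a c
    rw [mul_minkowskiMatrix_mul]
    exact (W.mul_tangentProj ⁅W.grad (W.coord a), v⁆ c).symm
  rw [sub_mul, sub_mul] at h
  linear_combination (norm := abel) h

theorem div_smul (f : Fn d S) (v : VF d S) : W.div (f • v) = f * W.div v + v f := by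
  rw [div_apply, W.derivation_apply v f, div_apply, Finset.mul_sum, ← Finset.sum_add_distrib]
  refine Finset.sum_congr rfl fun a _ => ?_
  rw [Derivation.smul_apply, smul_eq_mul, Derivation.leibniz, smul_add, smul_eq_mul, smul_eq_mul,
    mul_smul_comm]

/-- The divergence of a commutator. Expanding in `grad X^a` turns the difference of the two sides
into traces of products of `derivMatrix` and of derivatives of `tangentProj`, which cancel by
`trace_deriv_mul_comm`. -/
theorem div_lie (u v : VF d S) : W.div ⁅u, v⁆ = u (W.div v) - v (W.div u) := by
  have key (u v : VF d S) : ∑ a, (minkowski a : ℂ) • ⁅u, W.grad (W.coord a)⁆ (v (W.coord a)) =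
      (𝓗 * W.tangentProj.map u * 𝓗 * W.derivMatrix v).trace -
        (𝓗 * W.derivMatrix u * 𝓗 * W.derivMatrix v).trace := by
    rw [← Matrix.trace_sub, ← sub_mul, ← sub_mul, ← mul_sub, mul_assoc, mul_assoc, ← mul_assoc _ 𝓗,
      trace_minkowskiMatrix_mul]
    refine Finset.sum_congr rfl fun a _ => ?_
    rw [mul_minkowskiMatrix_mul, W.derivation_apply]
    rfl
  have hsymm := trace_deriv_mul_comm minkowskiMatrix_transpose W.tangentProj_transpose
    (W.map_tangentProj_transpose u) (W.map_tangentProj_transpose v) W.tangentProj_mul_self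
    (W.map_tangentProj u) (W.map_tangentProj v) (W.tangentProj_mul_derivMatrix v)
    (W.tangentProj_mul_derivMatrix u) (W.derivMatrix_sub v) (W.derivMatrix_sub u)
  have hcyc : (𝓗 * W.derivMatrix u * 𝓗 * W.derivMatrix v).trace =
      (𝓗 * W.derivMatrix v * 𝓗 * W.derivMatrix u).trace := by
    rw [mul_assoc (𝓗 * W.derivMatrix u), Matrix.trace_mul_comm, ← mul_assoc]
  have h : u (W.div v) - v (W.div u) - W.div ⁅u, v⁆ =
      ∑ a, (minkowski a : ℂ) • ⁅u, W.grad (W.coord a)⁆ (v (W.coord a)) -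
        ∑ a, (minkowski a : ℂ) • ⁅v, W.grad (W.coord a)⁆ (u (W.coord a)) := by
    simp only [div_apply, map_sum, Derivation.map_smul, ← Finset.sum_sub_distrib, ← smul_sub,
      Derivation.commutator_apply, map_sub]
    refine Finset.sum_congr rfl fun a _ => ?_
    congr 1
    abel
  rw [key, key, hsymm, hcyc, sub_self] at h
  exact (sub_eq_zero.1 h).symm

/-- The variation of the current `√-g grad X^a` along `dX v` is its Lie derivative along `v`. -/
theorem currentVariation_dX (v : VF d S) (a : Fin n) :
    W.currentVariation a (W.dX v) = ⁅v, W.grad (W.coord a)⁆ + W.div v • W.grad (W.coord a) := by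
  refine W.vf_ext fun c => ?_
  have hA := W.derivMatrix_sub v
  have hAt := congrArg Matrix.transpose hA
  simp only [Matrix.transpose_sub, Matrix.transpose_mul, tangentProj_transpose,
    minkowskiMatrix_transpose, map_tangentProj_transpose, ← mul_assoc] at hAt
  have hP := W.map_tangentProj v
  have hmat : (W.derivMatrix v).transpose - (W.derivMatrix v * 𝓗 * W.tangentProj +
      W.tangentProj * 𝓗 * (W.derivMatrix v).transpose) =
      W.tangentProj.map v - W.derivMatrix v := by
    linear_combination (norm := abel) hA + hAt + hP
  have h := congrFun (congrFun hmat a) c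
  rw [Matrix.sub_apply, Matrix.add_apply, mul_minkowskiMatrix_mul, mul_minkowskiMatrix_mul,
    ← Finset.sum_add_distrib] at h
  have hgrad (b : Fin n) : W.grad (v (W.coord b)) (W.coord c) = W.derivMatrix v c b :=
    W.pairing_comm _ _
  have hsum : ∑ b, (minkowski b : ℂ) • (W.grad (W.coord a) (v (W.coord b)) •
      W.grad (W.coord b) (W.coord c) +
      W.grad (W.coord a) (W.coord b) • W.grad (v (W.coord b)) (W.coord c)) =
      ∑ b, ((minkowski b : ℂ) • (W.derivMatrix v a b * W.tangentProj b c) +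
        (minkowski b : ℂ) • (W.tangentProj a b * (W.derivMatrix v).transpose b c)) := by
    refine Finset.sum_congr rfl fun b _ => ?_
    rw [hgrad, smul_add]
    rfl
  have hL : W.currentVariation a (W.dX v) (W.coord c) =
      W.grad (v (W.coord a)) (W.coord c) + W.div v • W.grad (W.coord a) (W.coord c) -
      ∑ b, (minkowski b : ℂ) • (W.grad (W.coord a) (v (W.coord b)) •
      W.grad (W.coord b) (W.coord c) +
      W.grad (W.coord a) (W.coord b) • W.grad (v (W.coord b)) (W.coord c)) := by
    change (W.grad (v (W.coord a)) + W.div v • W.grad (W.coord a) -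
      ∑ b, (minkowski b : ℂ) • (W.grad (W.coord a) (v (W.coord b)) • W.grad (W.coord b) +
      W.grad (W.coord a) (W.coord b) • W.grad (v (W.coord b)))) (W.coord c) = _
    rw [Derivation.sub_apply, Derivation.add_apply, Derivation.smul_apply,
      ← Derivation.coeFnAddMonoidHom_apply (∑ b, _)]
    simp only [map_sum, Finset.sum_apply, Derivation.coeFnAddMonoidHom_apply, Derivation.smul_apply,
      Derivation.add_apply]
  rw [hL, hsum, hgrad, Derivation.add_apply, Derivation.smul_apply, Derivation.commutator_apply]
  change W.derivMatrix v c a - _ = v (W.tangentProj a c) - W.derivMatrix v a c at h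
  rw [add_sub_right_comm, h]
  rfl

/-- Gauge invariance: on shell, tangential fluctuations solve the linearized equations. -/
theorem linearizedEOM_dX (hW : W.IsOnShell) (v : VF d S) : W.linearizedEOM (W.dX v) = 0 := by
  ext1 a
  change W.div (W.currentVariation a (W.dX v)) = 0
  have h0 : W.div (W.grad (W.coord a)) = 0 := hW a
  rw [currentVariation_dX, map_add, div_lie, div_smul, h0, map_zero, mul_zero]
  abel

end Background

/-! ### Ghost number on configurations -/

section GhostNumber

variable {d : ℕ} {S : Type*} [TopologicalSpace S] [ChartedSpace (EuclideanSpace ℝ (Fin d)) S]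
  {n : ℕ}

theorem Gen.sum_eq {M : Type*} [AddCommMonoid M] (f : Gen → M) : ∑ t, f t =
    f .Phi + (f .C + (f .Cbar + (f .B + (f .PhiStar + (f .CStar + (f .CbarStar + f .BStar)))))) := by
  change ∑ t ∈ {Gen.Phi, Gen.C, Gen.Cbar, Gen.B, Gen.PhiStar, Gen.CStar, Gen.CbarStar, Gen.BStar},
    f t = _
  simp

theorem sum_component (ψ : Config d S n) : ∑ t : Gen, component t ψ = ψ := by
  rw [Gen.sum_eq]
  simp [component, Prod.ext_iff]

theorem component_component (s t : Gen) (ψ : Config d S n) :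
    component s (component t ψ) = if s = t then component t ψ else 0 := by
  cases s <;> cases t <;> simp [component]

variable (d S n) in
/-- The configurations all of whose components have ghost number `m`. -/
def ghostSubspace (m : ℤ) : Submodule ℂ (Config d S n) where
  carrier := {ψ | ∀ t : Gen, t.gh ≠ m → component t ψ = 0}
  add_mem' h h' t ht := by rw [map_add, h t ht, h' t ht, add_zero]
  zero_mem' t _ := map_zero _
  smul_mem' c ψ h t ht := by
    rw [← algebraMap_smul (Fn d S) c ψ, map_smul, h t ht, smul_zero]

theorem component_mem_ghostSubspace (t : Gen) (ψ : Config d S n) :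
    component t ψ ∈ ghostSubspace d S n t.gh := by
  intro s hs
  rw [component_component, if_neg]
  rintro rfl
  exact hs rfl

theorem mem_ghostSubspace_of_component_eq {t : Gen} {ψ : Config d S n} (h : component t ψ = ψ) :
    ψ ∈ ghostSubspace d S n t.gh := h ▸ component_mem_ghostSubspace t ψ

theorem mem_ghostSubspace_iff {m : ℤ} {ψ : Config d S n} : ψ ∈ ghostSubspace d S n m ↔
    (0 ≠ m → ψ.1 = 0) ∧ (1 ≠ m → ψ.2.1 = 0) ∧ (-1 ≠ m → ψ.2.2.1 = 0) ∧
    (0 ≠ m → ψ.2.2.2.1 = 0) ∧ (-1 ≠ m → ψ.2.2.2.2.1 = 0) ∧ (-2 ≠ m → ψ.2.2.2.2.2.1 = 0) ∧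
    (0 ≠ m → ψ.2.2.2.2.2.2.1 = 0) ∧ (-1 ≠ m → ψ.2.2.2.2.2.2.2 = 0) := by
  change (∀ t : Gen, t.gh ≠ m → component t ψ = 0) ↔ _
  constructor
  · intro h
    have key (t : Gen) (ht : t.gh ≠ m) := h t ht
    exact ⟨fun hm => by simpa [component] using key .Phi hm,
      fun hm => by simpa [component] using key .C hm,
      fun hm => by simpa [component] using key .Cbar hm,
      fun hm => by simpa [component] using key .B hm,
      fun hm => by simpa [component] using key .PhiStar hm,
      fun hm => by simpa [component] using key .CStar hm,
      fun hm => by simpa [component] using key .CbarStar hm,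
      fun hm => by simpa [component] using key .BStar hm⟩
  · rintro ⟨h1, h2, h3, h4, h5, h6, h7, h8⟩ t ht
    cases t <;> simp only [Gen.gh] at ht <;> simp [component, *]

theorem parity_apply (ψ : Config d S n) : parity ψ = (ψ.1, -ψ.2.1, -ψ.2.2.1, ψ.2.2.2.1,
    -ψ.2.2.2.2.1, ψ.2.2.2.2.2.1, ψ.2.2.2.2.2.2.1, -ψ.2.2.2.2.2.2.2) := by
  have h2 : Int.negOnePow 2 = 1 := Int.negOnePow_even 2 even_two
  rw [parity, Gen.sum_eq]
  simp [component, Gen.gh, h2]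

theorem parity_parity (ψ : Config d S n) : parity (parity ψ) = ψ := by
  simp [parity_apply]

theorem parity_of_mem {m : ℤ} {ψ : Config d S n} (h : ψ ∈ ghostSubspace d S n m) :
    parity ψ = ((m.negOnePow : ℤˣ) : ℤ) • ψ := by
  conv_rhs => rw [← sum_component ψ, Finset.smul_sum]
  rw [parity, LinearMap.sum_apply]
  refine Finset.sum_congr rfl fun t _ => ?_
  by_cases ht : t.gh = m
  · rw [ht]; rfl
  · rw [LinearMap.smul_apply, h t ht, smul_zero, smul_zero]

theorem parity_mem {m : ℤ} {ψ : Config d S n} (h : ψ ∈ ghostSubspace d S n m) :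
    parity ψ ∈ ghostSubspace d S n m := by
  rw [parity_of_mem h]
  exact zsmul_mem h _

end GhostNumber

/-! ### Orders of vanishing -/

section Order

variable {d : ℕ} {S : Type*} [TopologicalSpace S] [ChartedSpace (EuclideanSpace ℝ (Fin d)) S]
  {n : ℕ}

/-- An operator on configurations that lowers the order of vanishing by at most two, as do the
differential operators of order at most two: it maps `I^(r+2)`-multiples into `I^r`-multiples. -/
def OrderLETwo (A : Config d S n →ₗ[ℂ] Config d S n) : Prop :=
  ∀ (I : Ideal (Fn d S)) (r : ℕ), ∀ f ∈ I ^ (r + 2), ∀ ψ : Config d S n,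
    A (f • ψ) ∈ I ^ r • (⊤ : Submodule (Fn d S) (Config d S n))

theorem OrderLETwo.of_linear (A : Config d S n →ₗ[Fn d S] Config d S n) :
    OrderLETwo (A.restrictScalars ℂ) := by
  intro I r f hf ψ
  rw [LinearMap.restrictScalars_apply, map_smul]
  exact Submodule.smul_mem_smul (Ideal.pow_le_pow_right (by omega) hf) trivial

theorem OrderLETwo.sub {A B : Config d S n →ₗ[ℂ] Config d S n} (hA : OrderLETwo A)
    (hB : OrderLETwo B) : OrderLETwo (A - B) := fun I r f hf ψ =>
  Submodule.sub_mem _ (hA I r f hf ψ) (hB I r f hf ψ)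

theorem OrderLETwo.id : OrderLETwo (LinearMap.id : Config d S n →ₗ[ℂ] Config d S n) :=
  OrderLETwo.of_linear LinearMap.id

theorem derivation_mem_pow (v : VF d S) (I : Ideal (Fn d S)) (r : ℕ) :
    ∀ f ∈ I ^ (r + 1), v f ∈ I ^ r := by
  induction r with
  | zero => intro f _; simp
  | succ r ih =>
    intro f hf
    rw [pow_succ] at hf
    refine Submodule.mul_induction_on hf (fun a ha b hb => ?_) fun a b ha hb => ?_
    · rw [Derivation.leibniz, smul_eq_mul, smul_eq_mul]
      refine add_mem (Ideal.mul_mem_right _ _ ha) ?_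
      rw [pow_succ, mul_comm b]
      exact Ideal.mul_mem_mul (ih a ha) hb
    · rw [map_add]
      exact add_mem ha hb

end Order

/-! ### The contracting operator on configurations -/

namespace Background

variable {d : ℕ} {S : Type*} [TopologicalSpace S] [ChartedSpace (EuclideanSpace ℝ (Fin d)) S]
  {n : ℕ} (W : Background d S n) [IsManifold (𝓡 d) ∞ S]

/-- The d'Alembertian is `h_ab grad X^a grad X^b`, and each derivation lowers the order of vanishing
by at most one. -/
theorem box_mem_pow (I : Ideal (Fn d S)) (r : ℕ) (f : Fn d S) (hf : f ∈ I ^ (r + 2)) :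
    W.box f ∈ I ^ r := by
  change W.div (W.grad f) ∈ _
  rw [div_apply]
  refine sum_mem fun a _ => ?_
  rw [Algebra.smul_def]
  refine Ideal.mul_mem_left _ _ (derivation_mem_pow _ I r _ ?_)
  have h : W.grad f (W.coord a) = W.grad (W.coord a) f := W.pairing_comm _ _
  rw [h]
  exact derivation_mem_pow _ I (r + 1) _ hf

/-- The tangential part `g^μν h_ab ∂_ν X^a φ^b` of a fluctuation `φ`, as a vector field. -/
noncomputable def tangentialPart : (Fin n → Fn d S) →ₗ[Fn d S] VF d S where
  toFun φ := ∑ a, φ a • ((minkowski a : ℂ) • W.grad (W.coord a))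
  map_add' φ χ := by simp only [Pi.add_apply, add_smul, Finset.sum_add_distrib]
  map_smul' f φ := by
    simp only [Pi.smul_apply, smul_eq_mul, mul_smul, Finset.smul_sum, RingHom.id_apply]

theorem tangentialPart_dX [T2Space S] (v : VF d S) : W.tangentialPart (W.dX v) = v := by
  ext1 f
  rw [W.derivation_apply v f]
  change (∑ a, v (W.coord a) • ((minkowski a : ℂ) • W.grad (W.coord a))) f = _
  rw [← Derivation.coeFnAddMonoidHom_apply, map_sum, Finset.sum_apply]
  refine Finset.sum_congr rfl fun a _ => ?_
  rw [Derivation.coeFnAddMonoidHom_apply, Derivation.smul_apply, Derivation.smul_apply,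
    smul_eq_mul, mul_smul_comm]

/-- The contracting operator on configurations: it moves the tangential part of the fluctuation
into the ghost. -/
noncomputable def ghostHomotopy : Config d S n →ₗ[Fn d S] Config d S n where
  toFun ψ := (0, W.tangentialPart ψ.1, 0, 0, 0, 0, 0, 0)
  map_add' ψ χ := by simp
  map_smul' f ψ := by simp

theorem ghostHomotopy_apply (ψ : Config d S n) :
    W.ghostHomotopy ψ = (0, W.tangentialPart ψ.1, 0, 0, 0, 0, 0, 0) := rfl

variable (ζ : ℝ)

theorem freeBV_apply (ψ : Config d S n) : W.freeBV ζ ψ = (W.dX ψ.2.1, 0,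
    Complex.I • ψ.2.2.2.1, 0,
    -lower (W.linearizedEOM ψ.1) - (ζ : ℂ) • lower (W.boxVec (W.dX ψ.2.2.2.1)),
    W.dXT (ψ.2.2.2.2.1 - ((ζ : ℂ) * Complex.I) • lower (W.boxVec (W.dX ψ.2.2.1))),
    W.dXT (((ζ : ℂ) * Complex.I) • lower (W.boxVec (W.dX ψ.2.1))),
    -(Complex.I • ψ.2.2.2.2.2.2.1) - W.dXT ((ζ : ℂ) • lower (W.boxVec ψ.1))) := rfl

/-- The anticommutator of `freeBV` with `ghostHomotopy`: a projection, whose image is spanned by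
the ghosts and the images under `freeBV` of the ghosts. On shell it commutes with `freeBV`. -/
noncomputable def gaugeProj : Config d S n →ₗ[ℂ] Config d S n :=
  W.freeBV ζ ∘ₗ W.ghostHomotopy.restrictScalars ℂ + W.ghostHomotopy.restrictScalars ℂ ∘ₗ W.freeBV ζ

theorem gaugeProj_eq (ψ : Config d S n) : W.gaugeProj ζ ψ =
    W.freeBV ζ (W.ghostHomotopy ψ) + W.ghostHomotopy (W.freeBV ζ ψ) := rfl

theorem gaugeProj_apply [T2Space S] (ψ : Config d S n) : W.gaugeProj ζ ψ =
    (W.dX (W.tangentialPart ψ.1), ψ.2.1, 0, 0, 0, 0,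
      W.dXT (((ζ : ℂ) * Complex.I) • lower (W.boxVec (W.dX (W.tangentialPart ψ.1)))), 0) := by
  simp [gaugeProj_eq, ghostHomotopy_apply, freeBV_apply, tangentialPart_dX]

theorem gaugeProj_gaugeProj [T2Space S] (ψ : Config d S n) :
    W.gaugeProj ζ (W.gaugeProj ζ ψ) = W.gaugeProj ζ ψ := by
  simp [gaugeProj_apply, tangentialPart_dX]

/-- The component in `Φ‡` is where gauge invariance of the linearized equations is needed. -/
theorem gaugeProj_freeBV [T2Space S] (hW : W.IsOnShell) (ψ : Config d S n) :
    W.gaugeProj ζ (W.freeBV ζ ψ) = W.freeBV ζ (W.gaugeProj ζ ψ) := by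
  have hT (c : ℂ) (χ : Fin n → Fn d S) : W.dXT (c • χ) = c • W.dXT χ :=
    (W.dXT.restrictScalars ℂ).map_smul c χ
  have hI : Complex.I * ((ζ : ℂ) * Complex.I) = -ζ := by
    rw [mul_left_comm, Complex.I_mul_I, mul_neg_one]
  simp [gaugeProj_apply, freeBV_apply, tangentialPart_dX, W.linearizedEOM_dX hW, hT, smul_smul, hI]

theorem gaugeProj_parity [T2Space S] (ψ : Config d S n) :
    W.gaugeProj ζ (parity ψ) = parity (W.gaugeProj ζ ψ) := by
  simp [gaugeProj_apply, parity_apply]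

theorem freeBV_parity (ψ : Config d S n) :
    W.freeBV ζ (parity ψ) = -parity (W.freeBV ζ ψ) := by
  simp [freeBV_apply, parity_apply]
  exact ⟨by abel, by abel, by abel⟩

theorem ghostHomotopy_parity (ψ : Config d S n) :
    W.ghostHomotopy (parity ψ) = -parity (W.ghostHomotopy ψ) := by
  simp [ghostHomotopy_apply, parity_apply]

theorem ghostHomotopy_mem {m : ℤ} {ψ : Config d S n} (h : ψ ∈ ghostSubspace d S n m) :
    W.ghostHomotopy ψ ∈ ghostSubspace d S n (m + 1) := by
  rw [mem_ghostSubspace_iff] at h ⊢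
  simp only [ghostHomotopy_apply, implies_true, true_and, and_true]
  intro hm
  rw [h.1 (by omega), map_zero]

theorem gaugeProj_mem [T2Space S] {m : ℤ} {ψ : Config d S n} (h : ψ ∈ ghostSubspace d S n m) :
    W.gaugeProj ζ ψ ∈ ghostSubspace d S n m := by
  rw [mem_ghostSubspace_iff] at h ⊢
  simp only [gaugeProj_apply, implies_true, true_and, and_true]
  refine ⟨fun hm => ?_, h.2.1, fun hm => ?_⟩ <;> simp [h.1 hm]

theorem orderLETwo_gaugeProj [T2Space S] : OrderLETwo (W.gaugeProj ζ) := by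
  intro I r f hf ψ
  have hf' : f ∈ I ^ r := Ideal.pow_le_pow_right (by omega) hf
  -- an antifield all of whose components lie in `I^r`
  have hvec (φ : Fin n → Fn d S) (hφ : ∀ a, φ a ∈ I ^ r) :
      φ ∈ I ^ r • (⊤ : Submodule (Fn d S) (Fin n → Fn d S)) := by
    rw [pi_eq_sum_univ φ]
    exact sum_mem fun a _ => Submodule.smul_mem_smul (hφ a) trivial
  have hmap {M N : Type _} [AddCommGroup M] [Module (Fn d S) M] [AddCommGroup N]
      [Module (Fn d S) N] (A : M →ₗ[Fn d S] N) {x : M}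
      (hx : x ∈ I ^ r • (⊤ : Submodule (Fn d S) M)) :
      A x ∈ I ^ r • (⊤ : Submodule (Fn d S) N) := by
    have := Submodule.mem_map_of_mem (f := A) hx
    rw [Submodule.map_smul''] at this
    exact Submodule.smul_mono le_rfl le_top this
  have hsplit : W.gaugeProj ζ (f • ψ) =
      f • ((W.dX (W.tangentialPart ψ.1), ψ.2.1, 0, 0, 0, 0, 0, 0) : Config d S n) +
      (0, 0, 0, 0, 0, 0, W.dXT (((ζ : ℂ) * Complex.I) • lower (W.boxVec (f • W.dX
        (W.tangentialPart ψ.1)))), 0) := by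
    simp [gaugeProj_apply]
  rw [hsplit]
  refine add_mem (Submodule.smul_mem_smul hf' trivial) ?_
  let ι : OneForm d S →ₗ[Fn d S] Config d S n :=
    { toFun := fun χ => (0, 0, 0, 0, 0, 0, χ, 0)
      map_add' := fun χ χ' => by simp
      map_smul' := fun f χ => by simp }
  refine hmap (ι ∘ₗ W.dXT) (hvec _ fun a => ?_)
  change ((ζ : ℂ) * Complex.I) • (minkowski a : ℂ) • W.box (f * W.dX (W.tangentialPart ψ.1) a) ∈ _
  rw [Algebra.smul_def, Algebra.smul_def]
  exact Ideal.mul_mem_left _ _ (Ideal.mul_mem_left _ _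
    (W.box_mem_pow I r _ (Ideal.mul_mem_right _ _ hf)))

end Background

/-! ### Multilinear kernels -/

section Multilinear

variable {V M : Type*} [AddCommGroup V] [Module ℂ V] [AddCommGroup M] [Module ℂ M] {k : ℕ}
  (F : MultilinearMap ℂ (fun _ : Fin k => V) M)

theorem map_update_zsmul (ψ : Fin k → V) (i : Fin k) (z : ℤ) (x : V) :
    F (Function.update ψ i (z • x)) = z • F (Function.update ψ i x) := by
  rw [← Int.cast_smul_eq_zsmul ℂ z x, F.map_update_smul, Int.cast_smul_eq_zsmul]

theorem map_eq_zsmul_of_eq_update {ψ χ : Fin k → V} (i : Fin k) (z : ℤ) (hi : χ i = z • ψ i)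
    (h : ∀ j, j ≠ i → χ j = ψ j) : F χ = z • F ψ := by
  have : χ = Function.update ψ i (z • ψ i) := by
    funext j
    by_cases hj : j = i
    · subst hj; simp [hi]
    · simp [hj, h j hj]
  rw [this, map_update_zsmul, Function.update_eq_self]

end Multilinear

section Kernels

variable {d : ℕ} {S : Type*} [TopologicalSpace S] [ChartedSpace (EuclideanSpace ℝ (Fin d)) S]
  {n : ℕ} {p k : ℕ} {F G : MultilinearMap ℂ (fun _ : Fin k => Config d S n) (Cochain d S p)}

theorem map_eq_sum_component (F : MultilinearMap ℂ (fun _ : Fin k => Config d S n) (Cochain d S p))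
    (ψ : Fin k → Config d S n) :
    F ψ = ∑ τ : Fin k → Gen, F fun i => component (τ i) (ψ i) := by
  conv_lhs =>
    rw [show ψ = fun i => ∑ t, component t (ψ i) from funext fun i => (sum_component _).symm]
  exact F.map_sum fun i t => component t (ψ i)

/-- Homogeneous arguments may be used in `HasGhostNumber` in place of arguments of a fixed type. -/
theorem HasGhostNumber.apply_eq_zero {g : ℤ} (hF : HasGhostNumber g F) {m : Fin k → ℤ}
    {ψ : Fin k → Config d S n} (hψ : ∀ i, ψ i ∈ ghostSubspace d S n (m i)) (hm : ∑ i, m i ≠ g) :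
    F ψ = 0 := by
  rw [map_eq_sum_component]
  refine Finset.sum_eq_zero fun τ _ => ?_
  by_cases h : ∀ i, (τ i).gh = m i
  · exact hF τ _ (fun i => by rw [component_component, if_pos rfl]) (by simpa only [h] using hm)
  · push Not at h
    obtain ⟨i, hi⟩ := h
    exact F.map_coord_zero i (hψ i _ hi)

/-- Only the ghost has a positive ghost number. -/
theorem HasGhostNumber.apply_eq_zero_of_pos {g : ℤ} (hF : HasGhostNumber g F) (hg : 0 < g)
    {ψ : Fin k → Config d S n} (hψ : ∀ i, (ψ i).2.1 = 0) : F ψ = 0 := by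
  rw [map_eq_sum_component]
  refine Finset.sum_eq_zero fun τ _ => ?_
  by_cases h : ∃ i, τ i = .C
  · obtain ⟨i, hi⟩ := h
    exact F.map_coord_zero i (by simp [hi, component, hψ])
  · push Not at h
    refine hF τ _ (fun i => by rw [component_component, if_pos rfl]) (ne_of_lt ?_)
    refine lt_of_le_of_lt (Finset.sum_nonpos fun i _ => ?_) hg
    have := h i
    cases hi : τ i <;> simp_all [Gen.gh]

/-- Graded symmetry under the exchange of neighbouring homogeneous arguments. -/
theorem IsGradedSymmetric.apply_swap (hF : IsGradedSymmetric F) {i j : Fin k}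
    (hij : (j : ℕ) = i + 1) {s t : ℤ} {ψ : Fin k → Config d S n}
    (hs : ψ i ∈ ghostSubspace d S n s) (ht : ψ j ∈ ghostSubspace d S n t) :
    F (ψ ∘ Equiv.swap i j) = (((s * t).negOnePow : ℤˣ) : ℤ) • F ψ := by
  rw [map_eq_sum_component F ψ, map_eq_sum_component F (ψ ∘ _), Finset.smul_sum,
    ← ((Equiv.swap i j).arrowCongr (Equiv.refl Gen)).sum_comp]
  refine Finset.sum_congr rfl fun τ _ => ?_
  have h1 : (fun l => component (((Equiv.swap i j).arrowCongr (Equiv.refl Gen)) τ l)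
      ((ψ ∘ Equiv.swap i j) l)) = (fun l => component (τ l) (ψ l)) ∘ Equiv.swap i j := by
    funext l
    simp [Equiv.arrowCongr]
  rw [h1, hF i j hij (τ i) (τ j) _ (by rw [component_component, if_pos rfl])
    (by rw [component_component, if_pos rfl])]
  by_cases hi : (τ i).gh = s
  · by_cases hj : (τ j).gh = t
    · rw [hi, hj]
    · have h0 : F (fun l => component (τ l) (ψ l)) = 0 := F.map_coord_zero j (ht _ hj)
      rw [h0, smul_zero, smul_zero]
  · have h0 : F (fun l => component (τ l) (ψ l)) = 0 := F.map_coord_zero i (hs _ hi)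
    rw [h0, smul_zero, smul_zero]

theorem IsLocal.add (hF : IsLocal F) (hG : IsLocal G) : IsLocal (F + G) := by
  obtain ⟨r, hr⟩ := hF
  obtain ⟨r', hr'⟩ := hG
  refine ⟨max r r', fun x f hf ψ i v => ?_⟩
  have h1 := hr x f (Ideal.pow_le_pow_right (by omega) hf) ψ i v
  have h2 := hr' x f (Ideal.pow_le_pow_right (by omega) hf) ψ i v
  rw [_root_.add_apply, Pi.add_apply, map_add, h1, h2, add_zero]

theorem IsLocal.smul (c : ℂ) (hF : IsLocal F) : IsLocal (c • F) := by
  obtain ⟨r, hr⟩ := hF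
  refine ⟨r, fun x f hf ψ i v => ?_⟩
  rw [_root_.smul_apply, Pi.smul_apply, map_smul, hr x f hf ψ i v, smul_zero]

theorem IsLocal.sum {ι : Type*} (s : Finset ι)
    {H : ι → MultilinearMap ℂ (fun _ : Fin k => Config d S n) (Cochain d S p)}
    (hH : ∀ l ∈ s, IsLocal (H l)) : IsLocal (∑ l ∈ s, H l) :=
  Finset.sum_induction _ IsLocal (fun _ _ => IsLocal.add)
    ⟨0, fun _ _ _ _ _ _ => map_zero _⟩ hH

theorem IsLocal.comp (hF : IsLocal F) {L : Fin k → Config d S n →ₗ[ℂ] Config d S n}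
    (hL : ∀ i, OrderLETwo (L i)) : IsLocal (F.compLinearMap L) := by
  obtain ⟨r, hr⟩ := hF
  refine ⟨r + 2, fun x f hf ψ i v => ?_⟩
  have h1 : (F.compLinearMap L) (Function.update ψ i (f • ψ i)) =
      F (Function.update (fun j => L j (ψ j)) i (L i (f • ψ i))) := by
    rw [MultilinearMap.compLinearMap_apply]
    congr 1
    funext j
    by_cases hj : j = i
    · subst hj; simp
    · simp [hj]
  rw [h1]
  refine Submodule.smul_induction_on (p := fun χ => evalAt (d := d) x
    (F (Function.update (fun j => L j (ψ j)) i χ) v) = 0)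
    (hL i _ (r + 1) f hf (ψ i)) (fun a ha χ _ => ?_) fun χ χ' h h' => ?_
  · have h2 := hr x a ha (Function.update (fun j => L j (ψ j)) i χ) i v
    rwa [Function.update_idem, Function.update_self] at h2
  · rw [F.map_update_add, Pi.add_apply, map_add, h, h', add_zero]

end Kernels

/-! ### Odd derivations of functionals -/

section Derivations

variable {d : ℕ} {S : Type*} [TopologicalSpace S] [ChartedSpace (EuclideanSpace ℝ (Fin d)) S]
  {n : ℕ}

/-- The operators that act on the arguments in the `i`-th term of the odd derivation induced by
`A`: the parity before the `i`-th place, and `A` at that place. -/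
noncomputable def oddSlots (A : Config d S n →ₗ[ℂ] Config d S n) {k : ℕ} (i j : Fin k) :
    Config d S n →ₗ[ℂ] Config d S n :=
  if j < i then (parity (d := d) (S := S) (n := n)).restrictScalars ℂ
  else if j = i then A else LinearMap.id

theorem oddSlots_lt (A : Config d S n →ₗ[ℂ] Config d S n) {k : ℕ} {i j : Fin k} (h : j < i)
    (ψ : Config d S n) : oddSlots A i j ψ = parity ψ := by
  rw [oddSlots, if_pos h]; rfl

theorem oddSlots_self (A : Config d S n →ₗ[ℂ] Config d S n) {k : ℕ} (i : Fin k)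
    (ψ : Config d S n) : oddSlots A i i ψ = A ψ := by
  rw [oddSlots, if_neg (lt_irrefl i), if_pos rfl]

theorem oddSlots_gt (A : Config d S n →ₗ[ℂ] Config d S n) {k : ℕ} {i j : Fin k} (h : i < j)
    (ψ : Config d S n) : oddSlots A i j ψ = ψ := by
  rw [oddSlots, if_neg (not_lt.2 h.le), if_neg h.ne']; rfl

/-- The graded derivation of odd parity on functionals that is induced by an operator on
configurations; `s_0` is the one induced by `freeBV`. -/
noncomputable def oddDerivation (A : Config d S n →ₗ[ℂ] Config d S n) (p : ℕ) :
    Functional d S n p →ₗ[ℂ] Functional d S n p where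
  toFun F k := ∑ i : Fin k, (F k).compLinearMap (oddSlots A i)
  map_add' F χ := by
    funext k
    refine Eq.trans ?_ Finset.sum_add_distrib
    exact Finset.sum_congr rfl fun i _ => MultilinearMap.ext fun ψ => rfl
  map_smul' c F := by
    funext k
    change _ = c • (∑ i : Fin k, _ :
      MultilinearMap ℂ (fun _ : Fin k => Config d S n) (Cochain d S p))
    rw [Finset.smul_sum]
    exact Finset.sum_congr rfl fun i _ => MultilinearMap.ext fun ψ => rfl

theorem oddDerivation_apply (A : Config d S n →ₗ[ℂ] Config d S n) {p k : ℕ}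
    (F : Functional d S n p) (ψ : Fin k → Config d S n) :
    oddDerivation A p F k ψ = ∑ i, F k fun j => oddSlots A i j (ψ j) := by
  change (∑ i : Fin k, (F k).compLinearMap (oddSlots A i)) ψ = _
  rw [sum_apply]
  rfl

/-- The anticommutator of the odd derivations induced by two odd operators is the derivation induced
by the anticommutator of the operators. -/
theorem oddDerivation_anticomm {A B : Config d S n →ₗ[ℂ] Config d S n}
    (hA : ∀ ψ, A (parity ψ) = -parity (A ψ)) (hB : ∀ ψ, B (parity ψ) = -parity (B ψ)) {p k : ℕ}
    (F : Functional d S n p) (ψ : Fin k → Config d S n) :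
    oddDerivation A p (oddDerivation B p F) k ψ + oddDerivation B p (oddDerivation A p F) k ψ =
      ∑ i, F k (Function.update ψ i (A (B (ψ i)) + B (A (ψ i)))) := by
  have hpar (l i j : Fin k) (hl : j < l) (hi : j < i) (C D : Config d S n →ₗ[ℂ] Config d S n) :
      oddSlots C i j (oddSlots D l j (ψ j)) = ψ j := by
    rw [oddSlots_lt _ hl, oddSlots_lt _ hi, parity_parity]
  -- terms in which the two operators act at different places cancel
  have hne (l i : Fin k) (hli : l ≠ i) : F k (fun j => oddSlots A l j (oddSlots B i j (ψ j))) =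
      (-1 : ℤ) • F k (fun j => oddSlots B i j (oddSlots A l j (ψ j))) := by
    rcases lt_or_gt_of_ne hli with h | h
    · refine map_eq_zsmul_of_eq_update _ l _ ?_ fun j hj => ?_
      · rw [oddSlots_self, oddSlots_lt _ h, oddSlots_self, oddSlots_lt _ h, hA, neg_one_zsmul]
      · rcases lt_or_gt_of_ne hj with h' | h'
        · rw [hpar _ _ _ (h'.trans h) h', hpar _ _ _ h' (h'.trans h)]
        · rw [oddSlots_gt _ h', oddSlots_gt _ h']
    · refine map_eq_zsmul_of_eq_update _ i _ ?_ fun j hj => ?_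
      · rw [oddSlots_self, oddSlots_lt _ h, oddSlots_self, oddSlots_lt _ h, hB, neg_one_zsmul,
          neg_neg]
      · rcases lt_or_gt_of_ne hj with h' | h'
        · rw [hpar _ _ _ h' (h'.trans h), hpar _ _ _ (h'.trans h) h']
        · rw [oddSlots_gt _ h', oddSlots_gt _ h']
  have heq (i : Fin k) (C D : Config d S n →ₗ[ℂ] Config d S n) :
      (fun j => oddSlots C i j (oddSlots D i j (ψ j))) = Function.update ψ i (C (D (ψ i))) := by
    funext j
    rcases lt_trichotomy j i with h | h | h
    · rw [hpar _ _ _ h h, Function.update_of_ne h.ne]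
    · subst h; rw [oddSlots_self, oddSlots_self, Function.update_self]
    · rw [oddSlots_gt _ h, oddSlots_gt _ h, Function.update_of_ne h.ne']
  simp only [oddDerivation_apply]
  rw [Finset.sum_comm (f := fun i l => F k fun j => oddSlots A l j (oddSlots B i j (ψ j))),
    ← Finset.sum_add_distrib]
  refine Finset.sum_congr rfl fun l _ => ?_
  rw [← Finset.sum_add_distrib, Finset.sum_eq_single l]
  · rw [heq, heq, (F k).map_update_add, add_comm]
  · intro i _ hi
    rw [hne l i hi.symm, neg_one_zsmul, add_neg_cancel]
  · simp

end Derivations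

/-! ### Inverting the derivation induced by a projection -/

section Projection

variable {d : ℕ} {S : Type*} [TopologicalSpace S] [ChartedSpace (EuclideanSpace ℝ (Fin d)) S]
  {n : ℕ}

/-- The operators `N` at the places in `A`, and `1 - N` at the other places. -/
noncomputable def projSlots (N : Config d S n →ₗ[ℂ] Config d S n) {k : ℕ} (A : Finset (Fin k))
    (j : Fin k) : Config d S n →ₗ[ℂ] Config d S n :=
  if j ∈ A then N else LinearMap.id - N

theorem projSlots_mem (N : Config d S n →ₗ[ℂ] Config d S n) {k : ℕ} {A : Finset (Fin k)}
    {j : Fin k} (h : j ∈ A) (ψ : Config d S n) : projSlots N A j ψ = N ψ := by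
  rw [projSlots, if_pos h]

theorem projSlots_notMem (N : Config d S n →ₗ[ℂ] Config d S n) {k : ℕ} {A : Finset (Fin k)}
    {j : Fin k} (h : j ∉ A) (ψ : Config d S n) : projSlots N A j ψ = ψ - N ψ := by
  rw [projSlots, if_neg h]; rfl

/-- The inverse of the derivation induced by a projection `N`, on functionals whose part with
`1 - N` in all places vanishes: the part with `N` in exactly the places of `A` is an eigenvector
with eigenvalue `#A`. The part for `A = ∅` is dropped, as `0⁻¹ = 0`. -/
noncomputable def invNumber (N : Config d S n →ₗ[ℂ] Config d S n) (p : ℕ) :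
    Functional d S n p →ₗ[ℂ] Functional d S n p where
  toFun F k := ∑ A : Finset (Fin k), (A.card : ℂ)⁻¹ • (F k).compLinearMap (projSlots N A)
  map_add' F χ := by
    funext k
    refine Eq.trans ?_ Finset.sum_add_distrib
    exact Finset.sum_congr rfl fun A _ => smul_add (A.card : ℂ)⁻¹
      ((F k).compLinearMap (projSlots N A)) ((χ k).compLinearMap (projSlots N A))
  map_smul' c F := by
    funext k
    change _ = c • (∑ A : Finset (Fin k), _ :
      MultilinearMap ℂ (fun _ : Fin k => Config d S n) (Cochain d S p))
    rw [Finset.smul_sum]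
    exact Finset.sum_congr rfl fun A _ => smul_comm (A.card : ℂ)⁻¹ c
      ((F k).compLinearMap (projSlots N A))

theorem invNumber_eq (N : Config d S n →ₗ[ℂ] Config d S n) {p k : ℕ} (F : Functional d S n p) :
    invNumber N p F k = ∑ A : Finset (Fin k),
      (A.card : ℂ)⁻¹ • (F k).compLinearMap (projSlots N A) := rfl

theorem invNumber_apply (N : Config d S n →ₗ[ℂ] Config d S n) {p k : ℕ}
    (F : Functional d S n p) (ψ : Fin k → Config d S n) : invNumber N p F k ψ =
    ∑ A : Finset (Fin k), (A.card : ℂ)⁻¹ • F k fun j => projSlots N A j (ψ j) := by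
  rw [invNumber_eq, sum_apply]
  rfl

/-- `invNumber` commutes with the odd derivations induced by operators that commute with `N`. -/
theorem invNumber_oddDerivation {N D : Config d S n →ₗ[ℂ] Config d S n}
    (hD : ∀ ψ, N (D ψ) = D (N ψ)) (hN : ∀ ψ, N (parity ψ) = parity (N ψ)) (p : ℕ)
    (F : Functional d S n p) :
    invNumber N p (oddDerivation D p F) = oddDerivation D p (invNumber N p F) := by
  have hcomm {k : ℕ} (A : Finset (Fin k)) (i j : Fin k) (ψ : Config d S n) :
      oddSlots D i j (projSlots N A j ψ) = projSlots N A j (oddSlots D i j ψ) := by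
    have h : oddSlots D i j (N ψ) = N (oddSlots D i j ψ) := by
      rcases lt_trichotomy j i with h | h | h
      · rw [oddSlots_lt _ h, oddSlots_lt _ h, hN]
      · subst h; rw [oddSlots_self, oddSlots_self, hD]
      · rw [oddSlots_gt _ h, oddSlots_gt _ h]
    by_cases hj : j ∈ A
    · rw [projSlots_mem _ hj, projSlots_mem _ hj, h]
    · rw [projSlots_notMem _ hj, projSlots_notMem _ hj, map_sub, h]
  funext k
  refine MultilinearMap.ext fun ψ => ?_
  simp only [oddDerivation_apply, invNumber_apply, Finset.smul_sum, hcomm]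
  exact Finset.sum_comm

/-- On functionals that vanish on the kernel of `N`, `invNumber` is a right inverse of the
derivation induced by `N`. -/
theorem sum_update_invNumber {N : Config d S n →ₗ[ℂ] Config d S n}
    (hN : ∀ ψ, N (N ψ) = N ψ) {p k : ℕ} (F : Functional d S n p) (ψ : Fin k → Config d S n)
    (hF : F k (fun j => ψ j - N (ψ j)) = 0) :
    ∑ i, invNumber N p F k (Function.update ψ i (N (ψ i))) = F k ψ := by
  have hterm (i : Fin k) (A : Finset (Fin k)) :
      F k (fun j => projSlots N A j (Function.update ψ i (N (ψ i)) j)) =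
        if i ∈ A then F k (fun j => projSlots N A j (ψ j)) else 0 := by
    by_cases hi : i ∈ A
    · rw [if_pos hi]
      congr 1
      funext j
      by_cases hj : j = i
      · subst hj
        rw [Function.update_self, projSlots_mem _ hi, projSlots_mem _ hi, hN]
      · rw [Function.update_of_ne hj]
    · rw [if_neg hi]
      refine (F k).map_coord_zero i ?_
      rw [Function.update_self, projSlots_notMem _ hi, hN, sub_self]
  have hempty : F k (fun j => projSlots N ∅ j (ψ j)) = 0 := by
    rw [← hF]
    exact congrArg (F k) (funext fun j => projSlots_notMem _ (Finset.notMem_empty j) _)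
  have hexp : F k ψ = ∑ A : Finset (Fin k), F k fun j => projSlots N A j (ψ j) := by
    have h := (F k).map_add_univ (fun j => N (ψ j)) (fun j => ψ j - N (ψ j))
    rw [show ((fun j => N (ψ j)) + fun j => ψ j - N (ψ j)) = ψ from
      funext fun j => add_sub_cancel _ _] at h
    rw [h]
    refine Finset.sum_congr rfl fun A _ => congrArg _ (funext fun j => ?_)
    by_cases hj : j ∈ A
    · rw [projSlots_mem _ hj, Finset.piecewise_eq_of_mem _ _ _ hj]
    · rw [projSlots_notMem _ hj, Finset.piecewise_eq_of_notMem _ _ _ hj]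
  simp only [invNumber_apply, hterm]
  rw [Finset.sum_comm, hexp]
  refine Finset.sum_congr rfl fun A _ => ?_
  rw [← Finset.smul_sum, Finset.sum_ite_mem, Finset.univ_inter, Finset.sum_const,
    ← Nat.cast_smul_eq_nsmul ℂ, smul_smul]
  rcases A.eq_empty_or_nonempty with rfl | hA
  · rw [hempty, smul_zero]
  · rw [inv_mul_cancel₀ (Nat.cast_ne_zero.2 hA.card_pos.ne'), one_smul]

theorem hd_apply (p : ℕ) {k : ℕ} (F : Functional d S n p) (ψ : Fin k → Config d S n) :
    hd d S n p F k ψ = extd d S p (F k ψ) := rfl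

theorem oddDerivation_hd (A : Config d S n →ₗ[ℂ] Config d S n) (p : ℕ) (F : Functional d S n p) :
    oddDerivation A (p + 1) (hd d S n p F) = hd d S n p (oddDerivation A p F) := by
  funext k
  refine MultilinearMap.ext fun ψ => ?_
  simp only [hd_apply, oddDerivation_apply, map_sum]

theorem invNumber_hd (N : Config d S n →ₗ[ℂ] Config d S n) (p : ℕ) (F : Functional d S n p) :
    invNumber N (p + 1) (hd d S n p F) = hd d S n p (invNumber N p F) := by
  funext k
  refine MultilinearMap.ext fun ψ => ?_
  simp only [hd_apply, invNumber_apply, map_sum, map_smul]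

end Projection

/-! ### Stability of local forms -/

section LocalForms

variable {d : ℕ} {S : Type*} [TopologicalSpace S] [ChartedSpace (EuclideanSpace ℝ (Fin d)) S]
  {n : ℕ} {g : ℤ} {p : ℕ}

theorem invNumber_mem_localForms {N : Config d S n →ₗ[ℂ] Config d S n} (hN : OrderLETwo N)
    (hgh : ∀ m, ∀ ψ ∈ ghostSubspace d S n m, N ψ ∈ ghostSubspace d S n m)
    {F : Functional d S n p} (hF : F ∈ localForms d S n g p) :
    invNumber N p F ∈ localForms d S n g p := by
  obtain ⟨⟨K, hK⟩, h⟩ := hF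
  have hslot {k : ℕ} (A : Finset (Fin k)) (j : Fin k) {m : ℤ} {ψ : Config d S n}
      (hψ : ψ ∈ ghostSubspace d S n m) : projSlots N A j ψ ∈ ghostSubspace d S n m := by
    by_cases hj : j ∈ A
    · rw [projSlots_mem _ hj]; exact hgh m ψ hψ
    · rw [projSlots_notMem _ hj]; exact sub_mem hψ (hgh m ψ hψ)
  refine ⟨⟨K, fun k hk => MultilinearMap.ext fun ψ => ?_⟩, fun k => ⟨fun ψ => ?_, ?_, ?_, ?_⟩⟩
  · rw [invNumber_apply]
    exact Finset.sum_eq_zero fun A _ => by rw [hK k hk]; exact smul_zero _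
  · rw [invNumber_apply]
    exact sum_mem fun A _ => (diffForms d S p).smul_mem _ ((h k).1 _)
  · rw [invNumber_eq]
    refine IsLocal.sum _ fun A _ => IsLocal.smul _ ((h k).2.1.comp fun i => ?_)
    rw [projSlots]
    split_ifs
    exacts [hN, OrderLETwo.id.sub hN]
  · intro i j hij s t ψ hs ht
    rw [invNumber_apply, invNumber_apply, Finset.smul_sum,
      ← (Equiv.finsetCongr (Equiv.swap i j)).sum_comp]
    refine Finset.sum_congr rfl fun A _ => ?_
    have hperm : (fun l => projSlots N (Equiv.finsetCongr (Equiv.swap i j) A) l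
        ((ψ ∘ Equiv.swap i j) l)) = (fun l => projSlots N A l (ψ l)) ∘ Equiv.swap i j := by
      funext l
      have : l ∈ Equiv.finsetCongr (Equiv.swap i j) A ↔ Equiv.swap i j l ∈ A := by
        rw [Equiv.finsetCongr_apply, Finset.mem_map_equiv, Equiv.symm_swap]
      simp only [Function.comp_apply, projSlots, this]
    rw [hperm, (h k).2.2.1.apply_swap hij (hslot A i (mem_ghostSubspace_of_component_eq hs))
      (hslot A j (mem_ghostSubspace_of_component_eq ht)), Equiv.finsetCongr_apply,
      Finset.card_map, smul_comm]
  · intro τ ψ hτ hg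
    rw [invNumber_apply]
    refine Finset.sum_eq_zero fun A _ => ?_
    rw [(h k).2.2.2.apply_eq_zero (fun i => hslot A i (mem_ghostSubspace_of_component_eq (hτ i)))
      hg, smul_zero]

/-- The odd derivation induced by an operator of ghost number `1` on configurations lowers the ghost
number of local forms. -/
theorem oddDerivation_mem_localForms {A : Config d S n →ₗ[ℂ] Config d S n} (hA : OrderLETwo A)
    (hgh : ∀ m, ∀ ψ ∈ ghostSubspace d S n m, A ψ ∈ ghostSubspace d S n (m + 1))
    {F : Functional d S n p} (hF : F ∈ localForms d S n g p) :
    oddDerivation A p F ∈ localForms d S n (g - 1) p := by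
  obtain ⟨⟨K, hK⟩, h⟩ := hF
  have hslot {k : ℕ} {i j : Fin k} (hij : j ≠ i) {m : ℤ} {ψ : Config d S n}
      (hψ : ψ ∈ ghostSubspace d S n m) : oddSlots A i j ψ ∈ ghostSubspace d S n m := by
    rcases lt_or_gt_of_ne hij with h | h
    · rw [oddSlots_lt _ h]; exact parity_mem hψ
    · rwa [oddSlots_gt _ h]
  refine ⟨⟨K, fun k hk => MultilinearMap.ext fun ψ => ?_⟩, fun k => ⟨fun ψ => ?_, ?_, ?_, ?_⟩⟩
  · rw [oddDerivation_apply]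
    exact Finset.sum_eq_zero fun i _ => by rw [hK k hk]; rfl
  · rw [oddDerivation_apply]
    exact sum_mem fun A _ => (h k).1 _
  · refine IsLocal.sum Finset.univ fun i _ => (h k).2.1.comp fun j => ?_
    rw [oddSlots]
    split_ifs
    exacts [OrderLETwo.of_linear _, hA, OrderLETwo.id]
  · intro i j hij s t ψ hs ht
    have hs' := mem_ghostSubspace_of_component_eq hs
    have ht' := mem_ghostSubspace_of_component_eq ht
    have hlt : i < j := Fin.lt_def.2 (by omega)
    have hsymm := (h k).2.2.1
    rw [oddDerivation_apply, oddDerivation_apply, Finset.smul_sum,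
      ← Equiv.sum_comp (Equiv.swap i j)]
    refine Finset.sum_congr rfl fun l _ => ?_
    by_cases hli : l = i
    · subst hli
      -- `A` acts on the argument `ψ l` in its new, second place
      rw [Equiv.swap_apply_left]
      have hperm : (fun a => oddSlots A j a ((ψ ∘ Equiv.swap l j) a)) =
          Function.update (fun a => oddSlots A l a (ψ a)) j (parity (ψ j)) ∘ Equiv.swap l j := by
        funext a
        by_cases hal : a = l
        · subst hal
          simp only [Function.comp_apply, Equiv.swap_apply_left, Function.update_self]
          rw [oddSlots_lt _ hlt]
        by_cases haj : a = j
        · subst haj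
          simp only [Function.comp_apply, Equiv.swap_apply_right]
          rw [Function.update_of_ne hlt.ne, oddSlots_self, oddSlots_self]
        simp only [Function.comp_apply, Equiv.swap_apply_of_ne_of_ne hal haj]
        rw [Function.update_of_ne haj]
        rcases lt_or_gt_of_ne hal with h' | h'
        · rw [oddSlots_lt _ h', oddSlots_lt _ (h'.trans hlt)]
        · have : j < a := Fin.lt_def.2 (by
            have := Fin.lt_def.1 h'
            have := Fin.val_ne_of_ne haj
            omega)
          rw [oddSlots_gt _ h', oddSlots_gt _ this]
      rw [hperm, hsymm.apply_swap hij (s := s.gh + 1) (t := t.gh)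
        (by rw [Function.update_of_ne hlt.ne, oddSlots_self]; exact hgh _ _ hs')
        (by rw [Function.update_self]; exact parity_mem ht'),
        map_eq_zsmul_of_eq_update _ j ((t.gh.negOnePow : ℤˣ) : ℤ)
          (by rw [Function.update_self, oddSlots_gt _ hlt, parity_of_mem ht'])
          (fun a ha => Function.update_of_ne ha _ _), smul_smul]
      congr 1
      rw [← Units.val_mul, ← Int.negOnePow_add, add_mul, one_mul, add_assoc,
        Int.negOnePow_add, ← two_mul, Int.negOnePow_two_mul, mul_one]
    by_cases hlj : l = j
    · subst hlj
      rw [Equiv.swap_apply_right]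
      have hperm : (fun a => oddSlots A i a ((ψ ∘ Equiv.swap i l) a)) =
          Function.update (fun a => oddSlots A l a (ψ a)) i (ψ i) ∘ Equiv.swap i l := by
        funext a
        by_cases hai : a = i
        · subst hai
          simp only [Function.comp_apply, Equiv.swap_apply_left]
          rw [Function.update_of_ne hlt.ne', oddSlots_self, oddSlots_self]
        by_cases hal : a = l
        · subst hal
          simp only [Function.comp_apply, Equiv.swap_apply_right, Function.update_self]
          rw [oddSlots_gt _ hlt]
        simp only [Function.comp_apply, Equiv.swap_apply_of_ne_of_ne hai hal]
        rw [Function.update_of_ne hai]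
        rcases lt_or_gt_of_ne hai with h' | h'
        · rw [oddSlots_lt _ h', oddSlots_lt _ (h'.trans hlt)]
        · have : l < a := Fin.lt_def.2 (by
            have := Fin.lt_def.1 h'
            have := Fin.val_ne_of_ne hal
            omega)
          rw [oddSlots_gt _ h', oddSlots_gt _ this]
      have hθ : F k (fun a => oddSlots A l a (ψ a)) = ((s.gh.negOnePow : ℤˣ) : ℤ) •
          F k (Function.update (fun a => oddSlots A l a (ψ a)) i (ψ i)) :=
        map_eq_zsmul_of_eq_update _ i _
          (by rw [Function.update_self, oddSlots_lt _ hlt, parity_of_mem hs'])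
          (fun a ha => (Function.update_of_ne ha (ψ i) fun a => oddSlots A l a (ψ a)).symm)
      rw [hperm, hsymm.apply_swap hij (s := s.gh) (t := t.gh + 1)
        (by rw [Function.update_self]; exact hs')
        (by rw [Function.update_of_ne hlt.ne', oddSlots_self]; exact hgh _ _ ht'), hθ, smul_smul]
      congr 1
      rw [← Units.val_mul, ← Int.negOnePow_add, mul_add, mul_one]
    · rw [Equiv.swap_apply_of_ne_of_ne hli hlj]
      have hperm : (fun a => oddSlots A l a ((ψ ∘ Equiv.swap i j) a)) =
          (fun a => oddSlots A l a (ψ a)) ∘ Equiv.swap i j := by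
        have hiff : i < l ↔ j < l := by
          have := Fin.val_ne_of_ne hli
          have := Fin.val_ne_of_ne hlj
          rw [Fin.lt_def, Fin.lt_def]
          omega
        have hslots : oddSlots A l i = oddSlots A l j := by
          simp only [oddSlots, hiff, Ne.symm hli, Ne.symm hlj, if_false]
        funext a
        by_cases hai : a = i
        · subst hai; simp only [Function.comp_apply, Equiv.swap_apply_left, hslots]
        by_cases haj : a = j
        · subst haj; simp only [Function.comp_apply, Equiv.swap_apply_right, hslots]
        simp only [Function.comp_apply, Equiv.swap_apply_of_ne_of_ne hai haj]
      rw [hperm, hsymm.apply_swap hij (hslot (Ne.symm hli) hs') (hslot (Ne.symm hlj) ht')]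
  · intro τ ψ hτ hg
    rw [oddDerivation_apply]
    refine Finset.sum_eq_zero fun i _ => ?_
    refine (h k).2.2.2.apply_eq_zero (m := fun j => (τ j).gh + if j = i then 1 else 0)
      (fun j => ?_) ?_
    · by_cases hj : j = i
      · subst hj
        rw [if_pos rfl, oddSlots_self]
        exact hgh _ _ (mem_ghostSubspace_of_component_eq (hτ j))
      · rw [if_neg hj, add_zero]
        exact hslot hj (mem_ghostSubspace_of_component_eq (hτ j))
    · rw [Finset.sum_add_distrib, Finset.sum_ite_eq' Finset.univ i, if_pos (Finset.mem_univ i)]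
      omega

end LocalForms

/-! ### The homotopy on local forms -/

namespace Background

variable {d : ℕ} {S : Type*} [TopologicalSpace S] [ChartedSpace (EuclideanSpace ℝ (Fin d)) S]
  {n : ℕ} (W : Background d S n) [IsManifold (𝓡 d) ∞ S] (ζ : ℝ)

theorem s₀_eq_oddDerivation (p : ℕ) : W.s₀ ζ p = oddDerivation (W.freeBV ζ) p := rfl

/-- The contracting homotopy of `s_0` on functionals, combined with the inverse of the number
operator. -/
noncomputable def homotopy (p : ℕ) : Functional d S n p →ₗ[ℂ] Functional d S n p :=
  oddDerivation (W.ghostHomotopy.restrictScalars ℂ) p ∘ₗ invNumber (W.gaugeProj ζ) p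

theorem homotopy_hd (p : ℕ) (F : Functional d S n p) :
    W.homotopy ζ (p + 1) (hd d S n p F) = hd d S n p (W.homotopy ζ p F) := by
  change oddDerivation _ _ (invNumber _ _ _) = hd d S n p (oddDerivation _ _ (invNumber _ _ _))
  rw [invNumber_hd, oddDerivation_hd]

variable [T2Space S]

theorem homotopy_mem {g : ℤ} {p : ℕ} {F : Functional d S n p} (hF : F ∈ localForms d S n g p) :
    W.homotopy ζ p F ∈ localForms d S n (g - 1) p :=
  oddDerivation_mem_localForms (OrderLETwo.of_linear _) (fun _ _ => W.ghostHomotopy_mem)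
    (invNumber_mem_localForms (W.orderLETwo_gaugeProj ζ) (fun _ _ => W.gaugeProj_mem ζ) hF)

theorem s₀_homotopy (hW : W.IsOnShell) {g : ℤ} (hg : 0 < g) {p : ℕ} {F : Functional d S n p}
    (hF : F ∈ localForms d S n g p) :
    W.s₀ ζ p (W.homotopy ζ p F) + W.homotopy ζ p (W.s₀ ζ p F) = F := by
  rw [s₀_eq_oddDerivation]
  change oddDerivation _ p (oddDerivation _ p (invNumber _ p F)) +
    oddDerivation _ p (invNumber _ p _) = F
  rw [invNumber_oddDerivation (W.gaugeProj_freeBV ζ hW) (W.gaugeProj_parity ζ)]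
  funext k
  refine MultilinearMap.ext fun ψ => ?_
  have h := oddDerivation_anticomm (W.freeBV_parity ζ)
    (B := W.ghostHomotopy.restrictScalars ℂ) W.ghostHomotopy_parity
    (invNumber (W.gaugeProj ζ) p F) ψ
  refine h.trans (sum_update_invNumber (W.gaugeProj_gaugeProj ζ) F ψ ?_)
  refine (hF.2 k).2.2.2.apply_eq_zero_of_pos hg fun i => ?_
  rw [gaugeProj_apply]
  exact sub_self _

theorem homotopy_mem_dExact {g : ℤ} {p : ℕ} {F : Functional d S n p}
    (hF : F ∈ dExact (g + 1) p) : W.homotopy ζ p F ∈ dExact (n := n) g p := by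
  cases p with
  | zero =>
    rw [(Submodule.mem_bot ℂ).1 hF, map_zero]
    exact zero_mem _
  | succ p =>
    obtain ⟨G, hG, rfl⟩ := hF
    refine ⟨W.homotopy ζ p G, ?_, (W.homotopy_hd ζ p G).symm⟩
    simpa using W.homotopy_mem ζ hG

end Background

end NambuGoto

theorem mainTheorem1 {d n : ℕ} {S : Type*} [TopologicalSpace S] [T2Space S] [SigmaCompactSpace S]
    [ChartedSpace (EuclideanSpace ℝ (Fin d)) S] [IsManifold (𝓡 d) ∞ S]
    (W : NambuGoto.Background d S n) (hW : W.IsOnShell) (ζ : ℝ) (g : ℤ) (hg : 0 < g) (p : ℕ) :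
    Subsingleton (W.H ζ g p) ∧ Subsingleton (W.HRel ζ g p) := by
  constructor
  · rw [Submodule.Quotient.subsingleton_iff, Submodule.submoduleOf_eq_top]
    rintro F ⟨hF, hs⟩
    refine ⟨W.homotopy ζ p F, W.homotopy_mem ζ hF, ?_⟩
    have h := W.s₀_homotopy ζ hW hg hF
    rwa [LinearMap.mem_ker.1 hs, map_zero, add_zero] at h
  · rw [Submodule.Quotient.subsingleton_iff, Submodule.submoduleOf_eq_top]
    rintro F ⟨hF, hs⟩
    rw [← W.s₀_homotopy ζ hW hg hF]
    exact Submodule.add_mem_sup ⟨_, W.homotopy_mem ζ hF, rfl⟩ (W.homotopy_mem_dExact ζ hs)
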